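/- **Setting.** Rings are commutative with $1$, and schemes are separated. Fix a ring $A$. An *iterative Hasse–Schmidt system* $(\underline{\mathcal D},\Delta)$ over $A$ consists of a projective system $(\pi_{m,n}:\mathcal D_m\to\mathcal D_n)_{n\le m}$ of finite free algebra schemes with bases over $A$ (i.e. $\mathcal D_n(R)=R\otimes_A\mathcal D_n(A)$ with $\mathcal D_n(A)$ an $A$-algebra that is free of finite rank as a module, and the $\pi_{m,n}$ are induced by $A$-algebra homomorphisms), with $\pi_{m,n}$ surjective and $\mathcal D_0(R)=R$, together with closed embeddings of algebra schemes $\Delta_{(m,n)}:\mathcal D_{m+n}\to\mathcal D_m\circ\mathcal D_n$ (induced by $A$-algebra homomorphisms $\mathcal D_{m+n}(A)\to\mathcal D_m(A)\otimes_A\mathcal D_n(A)$) that are compatible with $\pi$, are associative ($\mathcal D_\ell(\Delta_{(m,n)})\circ\Delta_{(\ell,m+n)}=\Delta_{(\ell,m)}\circ\Delta_{(\ell+m,n)}$), and satisfy $\Delta_{(m,0)}=\Delta_{(0,n)}=\mathrm{id}$. An *iterative $\underline{\mathcal D}$-field* $(k,E)$ is a field $k$ that is an $A$-algebra, with $A$-algebra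 homomorphisms $E_n:k\to\mathcal D_n(k)$ such that $E_0=\mathrm{id}$, $\pi_{m,n}\circ E_m=E_n$, and $\Delta_{(m,n)}\circ E_{m+n}=\mathcal D_m(E_n)\circ E_m$. For a $k$-scheme $X$, the *$n$-th prolongation* $\tau_nX$, when it exists, is the Weil restriction from $\mathcal D_n(k)$ to $k$ (for the standard $k$-algebra structure) of the base change of $X$ along $E_n$; so $\tau_nX(R)=X(\mathcal D_n(R))$ for every $k$-algebra $R$, where $\mathcal D_n(R)$ is a $k$-algebra through $E_n$. The maps $E_n$, $\pi_{m,n}$ and $\Delta_{(m,n)}$ induce $\nabla_n:X(k)\to\tau_nX(k)$, $\hat\pi_{m,n}:\tau_mX\to\tau_nX$ and $\hat\Delta_{(m,n)}:\tau_{m+n}X\to\tau_n\tau_mX$. A *Hasse–Schmidt subvariety* $\underline Z=(Z_n)_{n\in\mathbb N}$ of $X$ over $k$ is a sequence of reduced closed subschemes $Z_n\subseteq\tau_nX$ over $k$, of finite type over $k$, such that $\hat\pi_{n+1,n}$ restricts to a morphism $Z_{n+1}\to Z_n$ for all $n$, and $\hat\Delta_{(m,1)}$ restricts to a morphism $Z_{m+1}\to\tau_1(Z_m)$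 for all $m$. Put $\underline Z(k)=\{p\in X(k):\nabla_n(p)\in Z_n(k)\text{ for all }n\}$. $\underline Z$ is *dominant* if all $Z_{n+1}\to Z_n$ are dominant, and *irreducible* if all $Z_n$ are irreducible. A *variety* over $k$ is a reduced (separated) scheme of finite type over $k$. Varieties whose Hasse–Schmidt subvarieties are considered are assumed to have all prolongations $\tau_nX$ and $\tau_n\tau_mX$ (as is the case for quasi-projective $X$). $(k,E)$ is *rich* if for every such variety $X$ over $k$ and every dominant irreducible Hasse–Schmidt subvariety $\underline Z$ of $X$ over $k$, the set $\nabla_n(\underline Z(k))$ is Zariski-dense in $Z_n$ for all $n\in\mathbb N$. **Proposition.** Let $(k,E)$ be a rich iterative $\underline{\mathcal D}$-field, $X$ a variety over $k$ such that $\tau_nX$ and $\tau_n\tau_mX$ exist for all $m,n\in\mathbb N$, and $\underline Z$ a dominant irreducible Hasse–Schmidt subvariety of $X$ over $k$. Then for each $m\in\mathbb N$ the prolongations $\tau_n(Z_m)$ exist for all $n$, and there is a dominant Hasse–Schmidt subvariety $\underline Y=(Y_n)$ of $Z_m$ over $k$ such that $$\nabla_m\big(\underline Z(k)\big)=\underline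 Y(k)$$ as subsets of $\tau_mX(k)$, and such that, for every $n$, $Y_n\subseteq\tau_n(Z_m)$ is the image of $Z_{m+n}$ under $\hat\Delta_{(m,n)}$; more precisely, $\hat\Delta_{(m,n)}:\tau_{m+n}X\to\tau_n\tau_mX$ restricts to an isomorphism from $Z_{m+n}$ onto $Y_n$. -/

import Mathlib

open CategoryTheory CategoryTheory.Limits AlgebraicGeometry TensorProduct

universe u

/-- A generalised Hasse-Schmidt system over `A`, presented by its `A`-points: a projective system of
finite free `A`-algebras `D n` with chosen bases, surjective transition maps `π`, and `D 0 = A`.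
The associated finite free algebra scheme is `R ↦ R ⊗[A] D n`. -/
structure HasseSchmidtSystem (A : Type u) [CommRing A] where
  D : ℕ → Type u
  [commRing : ∀ n, CommRing (D n)]
  [algebra : ∀ n, Algebra A (D n)]
  rank : ℕ → ℕ
  basis : ∀ n, Module.Basis (Fin (rank n)) A (D n)
  π : ∀ {m n : ℕ}, n ≤ m → D m →ₐ[A] D n
  π_self : ∀ n, π (le_refl n) = AlgHom.id A (D n)
  π_comp : ∀ {l m n : ℕ} (h : n ≤ m) (h' : m ≤ l), (π h).comp (π h') = π (h.trans h')
  π_surjective : ∀ {m n : ℕ} (h : n ≤ m), Function.Surjective (π h)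
  zero_bijective : Function.Bijective (algebraMap A (D 0))

attribute [instance] HasseSchmidtSystem.commRing HasseSchmidtSystem.algebra

/-- An iterative Hasse-Schmidt system. The composite `D m ∘ D n` is canonically `D m ⊗[A] D n`, so
`Δ m n` is the morphism `D (m + n) → D m ∘ D n`. Changes of index along equalities in `ℕ` are made
by the transition maps `π`. -/
structure IterativeHasseSchmidtSystem (A : Type u) [CommRing A] extends HasseSchmidtSystem A where
  Δ : ∀ m n : ℕ, D (m + n) →ₐ[A] D m ⊗[A] D n
  /-- `Δ m n` is a closed embedding of schemes: the comorphism, which is induced by the dual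
  `A`-linear map on the free `A`-modules of coordinates, is onto if and only if the dual linear map
  is onto, that is, if and only if `Δ m n` has an `A`-linear retraction. -/
  Δ_closedEmbedding : ∀ m n : ℕ, ∃ ρ : D m ⊗[A] D n →ₗ[A] D (m + n),
    ρ ∘ₗ (Δ m n).toLinearMap = LinearMap.id
  /-- compatibility with `π` -/
  Δ_π : ∀ {m n m' n' : ℕ} (hm : m' ≤ m) (hn : n' ≤ n),
    (Algebra.TensorProduct.map (π hm) (π hn)).comp (Δ m n) =
      (Δ m' n').comp (π (add_le_add hm hn))
  /-- associativity -/
  Δ_assoc : ∀ l m n : ℕ,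
    (Algebra.TensorProduct.map (AlgHom.id A (D l)) (Δ m n)).comp (Δ l (m + n)) =
      ((Algebra.TensorProduct.assoc A A A (D l) (D m) (D n)).toAlgHom.comp
        (Algebra.TensorProduct.map (Δ l m) (AlgHom.id A (D n)))).comp
          ((Δ (l + m) n).comp (π (add_assoc l m n).le))
  /-- `Δ (m, 0)` is the identity, modulo `D 0 = A` -/
  Δ_right_zero : ∀ m : ℕ, Δ m 0 = Algebra.TensorProduct.includeLeft
  /-- `Δ (0, n)` is the identity, modulo `D 0 = A` -/
  Δ_left_zero : ∀ n : ℕ, Δ 0 n =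
    (Algebra.TensorProduct.includeRight : D n →ₐ[A] D 0 ⊗[A] D n).comp (π (zero_add n).ge)

/-- An iterative Hasse-Schmidt ring structure on the `A`-algebra `k`: homomorphisms
`E n : k → D n (k)`, with `E 0 = id`, compatible with `π` and with `Δ`. -/
structure IterativeHasseSchmidtRing {A : Type u} [CommRing A] (S : IterativeHasseSchmidtSystem A)
    (k : Type u) [CommRing k] [Algebra A k] where
  E : ∀ n : ℕ, k →ₐ[A] k ⊗[A] S.D n
  E_zero : E 0 = Algebra.TensorProduct.includeLeft
  E_π : ∀ {m n : ℕ} (h : n ≤ m),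
    (Algebra.TensorProduct.map (AlgHom.id A k) (S.π h)).comp (E m) = E n
  /-- The composite `k → D m (k) → D m (D n (k))` of `E m` and `D m (E n)` is `Δ m n ∘ E (m + n)`;
  here `D m (D n (k)) = (k ⊗ D n) ⊗ D m` is identified with `k ⊗ (D m ⊗ D n)`. -/
  E_Δ : ∀ m n : ℕ,
    (Algebra.TensorProduct.map (E n) (AlgHom.id A (S.D m))).comp (E m) =
      (((Algebra.TensorProduct.assoc A A A k (S.D n) (S.D m)).symm.toAlgHom.comp
        (Algebra.TensorProduct.map (AlgHom.id A k)
          ((Algebra.TensorProduct.comm A (S.D m) (S.D n)).toAlgHom.comp (S.Δ m n)))).comp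
            (E (m + n)))

/-- A variety over a field: a reduced separated scheme of finite type, not necessarily
irreducible. -/
structure IsVarietyOver {k : Type u} [Field k] (X : Over (Spec (CommRingCat.of k))) : Prop where
  isReduced : IsReduced X.left
  isSeparated : IsSeparated X.hom
  locallyOfFiniteType : LocallyOfFiniteType X.hom
  quasiCompact : QuasiCompact X.hom

/-- The closed subscheme of a `k`-scheme `W` given by an ideal sheaf, as a `k`-scheme. -/
noncomputable def closedSub {B : Scheme.{u}} (W : Over B) (I : W.left.IdealSheafData) : Over B :=
  Over.mk (I.subschemeι ≫ W.hom)

/-- The inclusion of a closed subscheme. -/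
noncomputable def closedSubι {B : Scheme.{u}} (W : Over B) (I : W.left.IdealSheafData) :
    closedSub W I ⟶ W :=
  Over.homMk I.subschemeι

namespace IterativeHasseSchmidtRing

variable {A : Type u} [CommRing A] {S : IterativeHasseSchmidtSystem A}
variable {k : Type u} [CommRing k] [Algebra A k] (E : IterativeHasseSchmidtRing S k)

variable (S k) in
/-- The standard structure morphism `Spec D n (k) → Spec k`. -/
noncomputable def stdSpec (n : ℕ) :
    Spec (CommRingCat.of (k ⊗[A] S.D n)) ⟶ Spec (CommRingCat.of k) :=
  Spec.map (CommRingCat.ofHom (Algebra.TensorProduct.includeLeft : k →ₐ[A] k ⊗[A] S.D n).toRingHom)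

/-- The exponential structure morphism `Spec D n (k) → Spec k`. -/
noncomputable def expSpec (n : ℕ) :
    Spec (CommRingCat.of (k ⊗[A] S.D n)) ⟶ Spec (CommRingCat.of k) :=
  Spec.map (CommRingCat.ofHom (E.E n).toRingHom)

/-- The functor taking a `k`-scheme `U` to `U ×ₖ D n (k)`, viewed as a `k`-scheme through the
exponential `E n : k → D n (k)` (and not in the usual way). On `Spec R` it is the spectrum of
`D n (R)` with the exponential `k`-algebra structure. -/
noncomputable def thicken (n : ℕ) :
    Over (Spec (CommRingCat.of k)) ⥤ Over (Spec (CommRingCat.of k)) :=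
  Over.pullback (stdSpec S k n) ⋙ Over.map (E.expSpec n)

/-- The `n`-th prolongation `τ n X` of `X`: a `k`-scheme representing the functor
`U ↦ Homₖ (U ×ₖ D n (k), X)`, the product being a `k`-scheme through `E n`. Such morphisms are the
`D n (k)`-morphisms from `U ×ₖ D n (k)` to the base change of `X` along `E n`, so this is the Weil
restriction of that base change from `D n (k)` to `k`. -/
structure Prolongation (n : ℕ) (X : Over (Spec (CommRingCat.of k))) where
  obj : Over (Spec (CommRingCat.of k))
  rep : ((E.thicken n).op ⋙ yoneda.obj X).RepresentableBy obj

variable {E}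

/-- The canonical morphism `τ n X ×ₖ D n (k) → X`. -/
noncomputable def Prolongation.r {n : ℕ} {X : Over (Spec (CommRingCat.of k))}
    (T : E.Prolongation n X) : (E.thicken n).obj T.obj ⟶ X :=
  T.rep.homEquiv (𝟙 T.obj)

/-- The morphism `U → τ n X` that corresponds to a morphism `U ×ₖ D n (k) → X`. -/
noncomputable def Prolongation.lift {n : ℕ} {X U : Over (Spec (CommRingCat.of k))}
    (T : E.Prolongation n X) (g : (E.thicken n).obj U ⟶ X) : U ⟶ T.obj :=
  T.rep.homEquiv.symm g

theorem Prolongation.homEquiv_eq {n : ℕ} {X U : Over (Spec (CommRingCat.of k))}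
    (T : E.Prolongation n X) (f : U ⟶ T.obj) :
    T.rep.homEquiv f = (E.thicken n).map f ≫ T.r := by
  have h := T.rep.homEquiv_comp f (𝟙 T.obj)
  rw [Category.comp_id] at h
  exact h

theorem Prolongation.thicken_map_lift {n : ℕ} {X U : Over (Spec (CommRingCat.of k))}
    (T : E.Prolongation n X) (g : (E.thicken n).obj U ⟶ X) :
    (E.thicken n).map (T.lift g) ≫ T.r = g := by
  rw [← T.homEquiv_eq]
  exact T.rep.homEquiv.apply_symm_apply g

/-- Functoriality: `τ n (f) : τ n X → τ n Y`. -/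
noncomputable def Prolongation.map {n : ℕ} {X Y : Over (Spec (CommRingCat.of k))}
    (T : E.Prolongation n X) (T' : E.Prolongation n Y) (f : X ⟶ Y) : T.obj ⟶ T'.obj :=
  T'.lift (T.r ≫ f)

/-- A morphism to `τ n W` factors through `τ n V → τ n W` if and only if the corresponding
morphism to `W` factors through `V → W`. -/
theorem Prolongation.factors_iff {n : ℕ} {V W U : Over (Spec (CommRingCat.of k))} (i : V ⟶ W)
    (T' : E.Prolongation n V) (T : E.Prolongation n W) (φ : U ⟶ T.obj) :
    (∃ f : U ⟶ T'.obj, f ≫ T'.map T i = φ) ↔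
      ∃ g : (E.thicken n).obj U ⟶ V, g ≫ i = (E.thicken n).map φ ≫ T.r := by
  constructor
  · rintro ⟨f, rfl⟩
    refine ⟨(E.thicken n).map f ≫ T'.r, ?_⟩
    rw [Functor.map_comp, Category.assoc, Category.assoc, Prolongation.map, T.thicken_map_lift]
  · rintro ⟨g, hg⟩
    refine ⟨T'.lift g, T.rep.homEquiv.injective ?_⟩
    rw [T.homEquiv_eq, T.homEquiv_eq, Functor.map_comp, Category.assoc, Prolongation.map,
      T.thicken_map_lift, ← Category.assoc, T'.thicken_map_lift, hg]

/-- The set of `k`-points `X(k)`. -/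
abbrev Point (X : Over (Spec (CommRingCat.of k))) : Type u :=
  Over.mk (𝟙 (Spec (CommRingCat.of k))) ⟶ X

/-- The map `∇ n : X(k) → τ n X (k)`: the point `p` goes to the `k`-point of `τ n X` that
corresponds to `Spec D n (k) → Spec k → X`, the composite of `Spec (E n)` and `p`. -/
noncomputable def Prolongation.nabla {n : ℕ} {X : Over (Spec (CommRingCat.of k))}
    (T : E.Prolongation n X) (p : Point X) : Point T.obj :=
  T.lift (Over.mkIdTerminal.from _ ≫ p)

variable (E)

theorem π_comp_stdSpec {m n : ℕ} (h : n ≤ m) :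
    Spec.map (CommRingCat.ofHom (Algebra.TensorProduct.map (AlgHom.id A k) (S.π h)).toRingHom) ≫
      stdSpec S k m = stdSpec S k n := by
  rw [stdSpec, stdSpec, ← Spec.map_comp, ← CommRingCat.ofHom_comp]
  congr 2
  ext x
  simp

theorem π_comp_expSpec {m n : ℕ} (h : n ≤ m) :
    Spec.map (CommRingCat.ofHom (Algebra.TensorProduct.map (AlgHom.id A k) (S.π h)).toRingHom) ≫
      E.expSpec m = E.expSpec n := by
  rw [expSpec, expSpec, ← Spec.map_comp, ← CommRingCat.ofHom_comp, ← E.E_π h]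
  rfl

variable (S) in
/-- The morphism of schemes `U ×ₖ D n (k) → U ×ₖ D m (k)` induced by `π : D m → D n`. -/
noncomputable def thickenπLeft {m n : ℕ} (h : n ≤ m) (U : Over (Spec (CommRingCat.of k))) :
    pullback U.hom (stdSpec S k n) ⟶ pullback U.hom (stdSpec S k m) :=
  pullback.lift (pullback.fst _ _)
    (pullback.snd _ _ ≫ Spec.map (CommRingCat.ofHom
      (Algebra.TensorProduct.map (AlgHom.id A k) (S.π h)).toRingHom))
    (by rw [Category.assoc, π_comp_stdSpec, pullback.condition])

/-- The morphism `U ×ₖ D n (k) → U ×ₖ D m (k)` induced by `π : D m → D n`; it is over `k` for the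
exponential structures. -/
noncomputable def thickenπ {m n : ℕ} (h : n ≤ m) (U : Over (Spec (CommRingCat.of k))) :
    (E.thicken n).obj U ⟶ (E.thicken m).obj U :=
  Over.homMk (U := Over.mk (pullback.snd U.hom (stdSpec S k n) ≫ E.expSpec n))
    (V := Over.mk (pullback.snd U.hom (stdSpec S k m) ≫ E.expSpec m)) (thickenπLeft S h U) (by
      change thickenπLeft S h U ≫ pullback.snd U.hom (stdSpec S k m) ≫ E.expSpec m =
        pullback.snd U.hom (stdSpec S k n) ≫ E.expSpec n
      rw [thickenπLeft, pullback.lift_snd_assoc, Category.assoc, π_comp_expSpec])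

/-- The `k`-scheme-theoretic double thickening `(U ×ₖ D n (k)) ×ₖ D m (k)`, the second product being
formed through the exponential structure `E n`. -/
noncomputable abbrev doubleThicken (m n : ℕ) (U : Over (Spec (CommRingCat.of k))) : Scheme.{u} :=
  pullback (pullback.snd U.hom (stdSpec S k n) ≫ E.expSpec n) (stdSpec S k m)

/-- The projection from `(U ×ₖ D n (k)) ×ₖ D m (k)` to the spectrum of
`D m (D n (k)) = (k ⊗ D n) ⊗ D m`, given on the two tensor factors by the projections to
`Spec D n (k)` and to `Spec D m (k)`, the latter followed by `Spec D m (k) → Spec D m`. -/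
noncomputable def doubleThickenToSpec (m n : ℕ) (U : Over (Spec (CommRingCat.of k))) :
    E.doubleThicken m n U ⟶ Spec (CommRingCat.of ((k ⊗[A] S.D n) ⊗[A] S.D m)) :=
  pullback.lift (f := Spec.map (CommRingCat.ofHom (algebraMap A (k ⊗[A] S.D n))))
    (g := Spec.map (CommRingCat.ofHom (algebraMap A (S.D m))))
    (pullback.fst _ _ ≫ pullback.snd _ _)
    (pullback.snd _ _ ≫ Spec.map (CommRingCat.ofHom
      (Algebra.TensorProduct.includeRight : S.D m →ₐ[A] k ⊗[A] S.D m).toRingHom))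
    (by
      have h1 : Spec.map (CommRingCat.ofHom (algebraMap A (k ⊗[A] S.D n))) =
          E.expSpec n ≫ Spec.map (CommRingCat.ofHom (algebraMap A k)) := by
        rw [expSpec, ← Spec.map_comp, ← CommRingCat.ofHom_comp]
        congr 2
        ext x
        exact ((E.E n).commutes x).symm
      have h2 : Spec.map (CommRingCat.ofHom
            (Algebra.TensorProduct.includeRight : S.D m →ₐ[A] k ⊗[A] S.D m).toRingHom) ≫
            Spec.map (CommRingCat.ofHom (algebraMap A (S.D m))) =
          stdSpec S k m ≫ Spec.map (CommRingCat.ofHom (algebraMap A k)) := by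
        rw [stdSpec, ← Spec.map_comp, ← Spec.map_comp, ← CommRingCat.ofHom_comp,
          ← CommRingCat.ofHom_comp]
        congr 2
        ext x
        exact ((Algebra.TensorProduct.includeRight : S.D m →ₐ[A] k ⊗[A] S.D m).commutes x).trans
          ((Algebra.TensorProduct.includeLeft : k →ₐ[A] k ⊗[A] S.D m).commutes x).symm
      have h3 := pullback.condition (f := pullback.snd U.hom (stdSpec S k n) ≫ E.expSpec n)
        (g := stdSpec S k m)
      have h4 := congrArg (fun f => f ≫ Spec.map (CommRingCat.ofHom (algebraMap A k))) h3
      simp only [Category.assoc] at h4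
      rw [Category.assoc, Category.assoc, h1, h2]
      exact h4) ≫
    (pullbackSpecIso A (k ⊗[A] S.D n) (S.D m)).hom

variable (S k) in
/-- The homomorphism `Δ : D (m + n) (k) → D m (D n (k))`. -/
noncomputable def ΔHom (m n : ℕ) : k ⊗[A] S.D (m + n) →ₐ[A] (k ⊗[A] S.D n) ⊗[A] S.D m :=
  (Algebra.TensorProduct.assoc A A A k (S.D n) (S.D m)).symm.toAlgHom.comp
    (Algebra.TensorProduct.map (AlgHom.id A k)
      ((Algebra.TensorProduct.comm A (S.D m) (S.D n)).toAlgHom.comp (S.Δ m n)))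

theorem doubleThickenToSpec_comp_left (m n : ℕ) (U : Over (Spec (CommRingCat.of k))) :
    E.doubleThickenToSpec m n U ≫ Spec.map (CommRingCat.ofHom
      (Algebra.TensorProduct.includeLeft :
        k ⊗[A] S.D n →ₐ[A] (k ⊗[A] S.D n) ⊗[A] S.D m).toRingHom) =
      pullback.fst _ _ ≫ pullback.snd _ _ := by
  have h : (Algebra.TensorProduct.includeLeft :
      k ⊗[A] S.D n →ₐ[A] (k ⊗[A] S.D n) ⊗[A] S.D m).toRingHom =
      Algebra.TensorProduct.includeLeftRingHom := rfl
  rw [h, doubleThickenToSpec, Category.assoc, pullbackSpecIso_hom_fst, pullback.lift_fst]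

theorem doubleThickenToSpec_comp_right (m n : ℕ) (U : Over (Spec (CommRingCat.of k))) :
    E.doubleThickenToSpec m n U ≫ Spec.map (CommRingCat.ofHom
      (Algebra.TensorProduct.includeRight :
        S.D m →ₐ[A] (k ⊗[A] S.D n) ⊗[A] S.D m).toRingHom) =
      pullback.snd _ _ ≫ Spec.map (CommRingCat.ofHom
        (Algebra.TensorProduct.includeRight : S.D m →ₐ[A] k ⊗[A] S.D m).toRingHom) := by
  have h := pullbackSpecIso_hom_snd A (k ⊗[A] S.D n) (S.D m)
  rw [doubleThickenToSpec, Category.assoc]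
  exact (congrArg _ h).trans (pullback.lift_snd _ _ _)

theorem doubleThickenToSpec_comp_map (m n : ℕ) (U : Over (Spec (CommRingCat.of k))) :
    E.doubleThickenToSpec m n U ≫ Spec.map (CommRingCat.ofHom
      (Algebra.TensorProduct.map (E.E n) (AlgHom.id A (S.D m))).toRingHom) =
      pullback.snd _ _ := by
  rw [← cancel_mono (pullbackSpecIso A k (S.D m)).inv]
  apply pullback.hom_ext
  · rw [Category.assoc, Category.assoc, Category.assoc, pullbackSpecIso_inv_fst, ← Spec.map_comp,
      ← CommRingCat.ofHom_comp]
    have h : (Algebra.TensorProduct.map (E.E n) (AlgHom.id A (S.D m))).toRingHom.comp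
        Algebra.TensorProduct.includeLeftRingHom =
        (Algebra.TensorProduct.includeLeft :
          k ⊗[A] S.D n →ₐ[A] (k ⊗[A] S.D n) ⊗[A] S.D m).toRingHom.comp (E.E n).toRingHom := by
      ext x
      simp
    rw [h, CommRingCat.ofHom_comp, Spec.map_comp, ← Category.assoc,
      doubleThickenToSpec_comp_left, Category.assoc]
    exact pullback.condition
  · rw [Category.assoc, Category.assoc, Category.assoc, pullbackSpecIso_inv_snd, ← Spec.map_comp,
      ← CommRingCat.ofHom_comp]
    have h : (Algebra.TensorProduct.map (E.E n) (AlgHom.id A (S.D m))).toRingHom.comp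
        (Algebra.TensorProduct.includeRight : S.D m →ₐ[A] k ⊗[A] S.D m).toRingHom =
        (Algebra.TensorProduct.includeRight :
          S.D m →ₐ[A] (k ⊗[A] S.D n) ⊗[A] S.D m).toRingHom := by
      ext x
      simp
    exact (congrArg (fun f => E.doubleThickenToSpec m n U ≫ Spec.map (CommRingCat.ofHom f)) h).trans
      (E.doubleThickenToSpec_comp_right m n U)

theorem doubleThickenToSpec_comp_Δ_std (m n : ℕ) (U : Over (Spec (CommRingCat.of k))) :
    (E.doubleThickenToSpec m n U ≫ Spec.map (CommRingCat.ofHom (ΔHom S k m n).toRingHom)) ≫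
      stdSpec S k (m + n) = (pullback.fst _ _ ≫ pullback.fst _ _) ≫ U.hom := by
  have h : (ΔHom S k m n).toRingHom.comp
      (Algebra.TensorProduct.includeLeft : k →ₐ[A] k ⊗[A] S.D (m + n)).toRingHom =
      (Algebra.TensorProduct.includeLeft :
        k ⊗[A] S.D n →ₐ[A] (k ⊗[A] S.D n) ⊗[A] S.D m).toRingHom.comp
        (Algebra.TensorProduct.includeLeft : k →ₐ[A] k ⊗[A] S.D n).toRingHom := by
    ext x
    simp [ΔHom, Algebra.TensorProduct.one_def]
  rw [stdSpec, Category.assoc, ← Spec.map_comp, ← CommRingCat.ofHom_comp, h,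
    CommRingCat.ofHom_comp, Spec.map_comp, ← Category.assoc, doubleThickenToSpec_comp_left,
    Category.assoc, Category.assoc]
  congr 1
  exact pullback.condition.symm

theorem doubleThickenToSpec_comp_Δ_exp (m n : ℕ) (U : Over (Spec (CommRingCat.of k))) :
    (E.doubleThickenToSpec m n U ≫ Spec.map (CommRingCat.ofHom (ΔHom S k m n).toRingHom)) ≫
      E.expSpec (m + n) = pullback.snd _ _ ≫ E.expSpec m := by
  have h : (ΔHom S k m n).toRingHom.comp (E.E (m + n)).toRingHom =
      (Algebra.TensorProduct.map (E.E n) (AlgHom.id A (S.D m))).toRingHom.comp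
        (E.E m).toRingHom :=
    congrArg AlgHom.toRingHom (E.E_Δ m n).symm
  have h' : E.expSpec (m + n) = Spec.map (CommRingCat.ofHom (E.E (m + n)).toRingHom) := rfl
  rw [h', Category.assoc, ← Spec.map_comp, ← CommRingCat.ofHom_comp, h,
    CommRingCat.ofHom_comp, Spec.map_comp, ← Category.assoc, doubleThickenToSpec_comp_map]
  rfl

/-- The morphism of schemes `(U ×ₖ D n (k)) ×ₖ D m (k) → U ×ₖ D (m + n) (k)` induced by `Δ`. -/
noncomputable def thickenΔLeft (m n : ℕ) (U : Over (Spec (CommRingCat.of k))) :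
    E.doubleThicken m n U ⟶ pullback U.hom (stdSpec S k (m + n)) :=
  pullback.lift (pullback.fst _ _ ≫ pullback.fst _ _)
    (E.doubleThickenToSpec m n U ≫ Spec.map (CommRingCat.ofHom (ΔHom S k m n).toRingHom))
    (E.doubleThickenToSpec_comp_Δ_std m n U).symm

/-- The morphism `(U ×ₖ D n (k)) ×ₖ D m (k) → U ×ₖ D (m + n) (k)` induced by
`Δ : D (m + n) → D m ∘ D n`; it is over `k` for the exponential structures. -/
noncomputable def thickenΔ (m n : ℕ) (U : Over (Spec (CommRingCat.of k))) :
    (E.thicken m).obj ((E.thicken n).obj U) ⟶ (E.thicken (m + n)).obj U :=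
  Over.homMk
    (U := Over.mk (pullback.snd (pullback.snd U.hom (stdSpec S k n) ≫ E.expSpec n)
      (stdSpec S k m) ≫ E.expSpec m))
    (V := Over.mk (pullback.snd U.hom (stdSpec S k (m + n)) ≫ E.expSpec (m + n)))
    (E.thickenΔLeft m n U) (by
      change E.thickenΔLeft m n U ≫ pullback.snd U.hom (stdSpec S k (m + n)) ≫
        E.expSpec (m + n) = pullback.snd _ _ ≫ E.expSpec m
      rw [thickenΔLeft, pullback.lift_snd_assoc, doubleThickenToSpec_comp_Δ_exp])

variable {E}

/-- The projection `τ m X → τ n X` induced by `π : D m → D n`. -/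
noncomputable def Prolongation.proj {m n : ℕ} (h : n ≤ m) {X : Over (Spec (CommRingCat.of k))}
    (T : E.Prolongation m X) (T' : E.Prolongation n X) : T.obj ⟶ T'.obj :=
  T'.lift (E.thickenπ h T.obj ≫ T.r)

/-- The morphism `τ (m + n) X ×ₖ D n (k) → τ m X` that corresponds to
`τ (m + n) X → τ n (τ m X)`. -/
noncomputable def Prolongation.deltaTranspose {m n : ℕ} {X : Over (Spec (CommRingCat.of k))}
    (T : E.Prolongation (m + n) X) (T' : E.Prolongation m X) :
    (E.thicken n).obj T.obj ⟶ T'.obj :=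
  T'.lift (E.thickenΔ m n T.obj ≫ T.r)

/-- The morphism `τ (m + n) X → τ n (τ m X)` induced by `Δ : D (m + n) → D m ∘ D n`. -/
noncomputable def Prolongation.delta {m n : ℕ} {X : Over (Spec (CommRingCat.of k))}
    (T : E.Prolongation (m + n) X) (T' : E.Prolongation m X) (T'' : E.Prolongation n T'.obj) :
    T.obj ⟶ T''.obj :=
  T''.lift (T.deltaTranspose T')

variable (E) in
/-- A choice of the prolongations `τ n X` of `X` for all `n`. They are unique up to unique
isomorphism. -/
abbrev Prolongations (X : Over (Spec (CommRingCat.of k))) : Type (u + 1) :=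
  ∀ n : ℕ, E.Prolongation n X

/-- A Hasse-Schmidt subscheme of `X` over `k`: closed subschemes `Z n` of `τ n X` such that
(1) `τ (n + 1) X → τ n X` restricts to a morphism `Z (n + 1) → Z n`, and
(2) `τ (m + 1) X → τ 1 (τ m X)` restricts to a morphism `Z (m + 1) → τ 1 (Z m)`.
By `Prolongation.factors_iff`, a morphism `U → τ 1 (τ m X)` factors through `τ 1 (Z m)` if and only
if the corresponding morphism from `U ×ₖ D 1 (k)` to `τ m X` factors through `Z m`, and (2) is
written in this form. -/
structure HSSubscheme {X : Over (Spec (CommRingCat.of k))} (τ : E.Prolongations X) where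
  Z : ∀ n : ℕ, (τ n).obj.left.IdealSheafData
  proj_restricts : ∀ n : ℕ,
    ∃ f : closedSub (τ (n + 1)).obj (Z (n + 1)) ⟶ closedSub (τ n).obj (Z n),
      f ≫ closedSubι _ _ = closedSubι _ _ ≫ (τ (n + 1)).proj (Nat.le_succ n) (τ n)
  delta_restricts : ∀ m : ℕ,
    ∃ f : (E.thicken 1).obj (closedSub (τ (m + 1)).obj (Z (m + 1))) ⟶ closedSub (τ m).obj (Z m),
      f ≫ closedSubι _ _ =
        (E.thicken 1).map (closedSubι _ _) ≫ (τ (m + 1)).deltaTranspose (τ m)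

namespace HSSubscheme

variable {X : Over (Spec (CommRingCat.of k))} {τ : E.Prolongations X} (Y : E.HSSubscheme τ)

/-- The `k`-scheme `Z n`. -/
noncomputable abbrev level (n : ℕ) : Over (Spec (CommRingCat.of k)) :=
  closedSub (τ n).obj (Y.Z n)

/-- The inclusion of `Z n` in `τ n X`. -/
noncomputable abbrev levelι (n : ℕ) : Y.level n ⟶ (τ n).obj :=
  closedSubι (τ n).obj (Y.Z n)

/-- The `k`-rational points: those `p` in `X(k)` with `∇ n (p)` in `Z n (k)` for all `n`. -/
def points : Set (Point X) :=
  {p | ∀ n : ℕ, ∃ q : Point (Y.level n), q ≫ Y.levelι n = (τ n).nabla p}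

/-- Each projection `Z (n + 1) → Z n` is dominant. -/
def Dominant : Prop :=
  ∀ n : ℕ, ∃ f : Y.level (n + 1) ⟶ Y.level n,
    f ≫ Y.levelι n = Y.levelι (n + 1) ≫ (τ (n + 1)).proj (Nat.le_succ n) (τ n) ∧
      IsDominant f.left

/-- Each `Z n` is irreducible. -/
def Irreducible : Prop :=
  ∀ n : ℕ, IrreducibleSpace (Y.level n).left

/-- Each `Z n` is reduced and of finite type over `k`. -/
def IsSubvariety : Prop :=
  ∀ n : ℕ, IsReduced (Y.level n).left ∧ LocallyOfFiniteType (Y.level n).hom ∧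
    QuasiCompact (Y.level n).hom

end HSSubscheme

/-- The Hasse-Schmidt field `(k, E)` is rich: for every variety `X` over `k` (whose prolongations
`τ n X` and `τ n (τ m X)` exist) and every dominant irreducible Hasse-Schmidt subvariety of `X`,
the set `∇ n (Z(k))` is Zariski-dense in `Z n`, for all `n`. -/
def Rich {A : Type u} [CommRing A] {S : IterativeHasseSchmidtSystem A} {k : Type u} [Field k]
    [Algebra A k] (E : IterativeHasseSchmidtRing S k) : Prop :=
  ∀ (X : Over (Spec (CommRingCat.of k))), IsVarietyOver X → ∀ (τ : E.Prolongations X),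
    (∀ m : ℕ, Nonempty (E.Prolongations (τ m).obj)) →
    ∀ Y : E.HSSubscheme τ, Y.IsSubvariety → Y.Dominant → Y.Irreducible →
      ∀ n : ℕ, closure (⋃ p ∈ Y.points, Set.range ((τ n).nabla p).left) =
        Set.range (Y.levelι n).left

end IterativeHasseSchmidtRing

/-! Write `δ` for the morphism `τ (m + n) X → τ n (τ m X)`. On `U`-points it is precomposition with
`thickenΔ : (U × D n) × D m → U × D (m + n)`. Three facts about `δ` and `τ n` carry the proof.

Prolongation of closed subschemes. `U × D n → U` is finite free with a basis compatible with base
change. For a closed `V ⊆ W`, the condition that `U × D n → W` lands in `V` is therefore cut out on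
`τ n W` by the coefficients of the pulled back equations. So `τ n V` exists, as a closed subscheme
of `τ n W` (`Prolongation.closed`).

`δ` is a closed immersion on a closed subscheme of finite type (`isClosedImmersion_comp_delta`). The
comorphism of `thickenΔ` is injective and remains so over every `U`, by flatness over the field. As
`X` is separated, `δ` is a monomorphism. For properness the valuative criterion asks that a morphism
to `X`, given over a valuation ring `O` on the source of `thickenΔ` and descended over the fraction
field `K`, descend over `O`. `X` is not affine, so descent is applied to the scheme-theoretic image
of a graph. That image is affine, and the question becomes one about functions: a function over `O`
upstairs that descends over `K` descends over `O`, because an injection of vector spaces has a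
linear retraction.

`δ` maps `Z (m + n)` into `τ n (Z m)` (`exists_comp_closedSubι_eq_delta`). It sends `∇ (m + n) p` to
`∇ n (∇ m p)`, which lies in `τ n (Z m)` for `p ∈ Z(k)`. By richness such points are dense in the
reduced scheme `Z (m + n)`.

Take `Y n` to be the image of `Z (m + n)`. Compatibility of `Δ` with `π` and associativity of `Δ`
turn the Hasse-Schmidt conditions for `Z` into those for `Y`. The inclusion `∇ m (Z(k)) ⊆ Y(k)` is
the formula for `δ` on `∇`. Conversely, for `q ∈ Y(k)` each `∇ n q` is `δ w` with `w ∈ Z (m +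
n)(k)`. If `p` is the point of `X` below `q`, the two counit laws of `Δ` identify `∇ n p` and `q`
with projections of `w`, whence `p ∈ Z(k)` and `∇ m p = q`. -/

namespace AlgebraicGeometry

/-! ### Spectra of tensor products. -/

/-- The morphism of spectra induced by a homomorphism of algebras. -/
noncomputable abbrev specAlgHom {A B C : Type u} [CommRing A] [CommRing B] [CommRing C]
    [Algebra A B] [Algebra A C] (f : B →ₐ[A] C) :
    Spec (CommRingCat.of C) ⟶ Spec (CommRingCat.of B) :=
  Spec.map (CommRingCat.ofHom f.toRingHom)

section

variable {A B C D : Type u} [CommRing A] [CommRing B] [CommRing C] [CommRing D]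
  [Algebra A B] [Algebra A C] [Algebra A D]

theorem specAlgHom_comp (f : B →ₐ[A] C) (g : C →ₐ[A] D) :
    specAlgHom g ≫ specAlgHom f = specAlgHom (g.comp f) := by
  rw [← Spec.map_comp, ← CommRingCat.ofHom_comp]
  rfl

theorem specAlgHom_comp_assoc {W : Scheme.{u}} (t : W ⟶ Spec (CommRingCat.of D))
    (f : B →ₐ[A] C) (g : C →ₐ[A] D) :
    (t ≫ specAlgHom g) ≫ specAlgHom f = t ≫ specAlgHom (g.comp f) := by
  rw [Category.assoc, specAlgHom_comp]

theorem specAlgHom_id : specAlgHom (AlgHom.id A B) = 𝟙 _ := Spec.map_id _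

theorem specAlgHom_structure (f : B →ₐ[A] C) :
    specAlgHom f ≫ Spec.map (CommRingCat.ofHom (algebraMap A B)) =
      Spec.map (CommRingCat.ofHom (algebraMap A C)) := by
  rw [← Spec.map_comp, ← CommRingCat.ofHom_comp]
  congr 2
  exact f.comp_algebraMap

/-- Two morphisms to `Spec (B ⊗[A] C)` agree if their components do. -/
theorem spec_tensor_hom_ext {W : Scheme.{u}} {f g : W ⟶ Spec (CommRingCat.of (B ⊗[A] C))}
    (h₁ : f ≫ specAlgHom (Algebra.TensorProduct.includeLeft : B →ₐ[A] B ⊗[A] C) =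
      g ≫ specAlgHom (Algebra.TensorProduct.includeLeft : B →ₐ[A] B ⊗[A] C))
    (h₂ : f ≫ specAlgHom (Algebra.TensorProduct.includeRight : C →ₐ[A] B ⊗[A] C) =
      g ≫ specAlgHom (Algebra.TensorProduct.includeRight : C →ₐ[A] B ⊗[A] C)) : f = g := by
  rw [← cancel_mono (pullbackSpecIso A B C).inv]
  apply pullback.hom_ext
  · rw [Category.assoc, Category.assoc, pullbackSpecIso_inv_fst]
    exact h₁
  · rw [Category.assoc, Category.assoc, pullbackSpecIso_inv_snd]
    exact h₂

theorem exists_spec_tensor_lift {W : Scheme.{u}} (b : W ⟶ Spec (CommRingCat.of B))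
    (c : W ⟶ Spec (CommRingCat.of C))
    (h : b ≫ Spec.map (CommRingCat.ofHom (algebraMap A B)) =
      c ≫ Spec.map (CommRingCat.ofHom (algebraMap A C))) :
    ∃ t : W ⟶ Spec (CommRingCat.of (B ⊗[A] C)),
      t ≫ specAlgHom (Algebra.TensorProduct.includeLeft : B →ₐ[A] B ⊗[A] C) = b ∧
      t ≫ specAlgHom (Algebra.TensorProduct.includeRight : C →ₐ[A] B ⊗[A] C) = c := by
  refine ⟨pullback.lift b c h ≫ (pullbackSpecIso A B C).hom, ?_, ?_⟩
  · have e := pullbackSpecIso_hom_fst A B C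
    rw [Category.assoc]
    exact (congrArg _ e).trans (pullback.lift_fst _ _ _)
  · have e := pullbackSpecIso_hom_snd A B C
    rw [Category.assoc]
    exact (congrArg _ e).trans (pullback.lift_snd _ _ _)

end

end AlgebraicGeometry

/-! ### Thickenings and the action of `π` and `Δ` on them. -/

namespace IterativeHasseSchmidtRing

open Algebra.TensorProduct (includeLeft includeRight)

variable {A : Type u} [CommRing A] {S : IterativeHasseSchmidtSystem A}
variable {k : Type u} [CommRing k] [Algebra A k] (E : IterativeHasseSchmidtRing S k)

/-- The projection `U ×ₖ D n (k) → U`. -/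
noncomputable def thickenFst (n : ℕ) (U : Over (Spec (CommRingCat.of k))) :
    ((E.thicken n).obj U).left ⟶ U.left :=
  pullback.fst U.hom (stdSpec S k n)

/-- The projection `U ×ₖ D n (k) → Spec D n (k)`. -/
noncomputable def thickenSnd (n : ℕ) (U : Over (Spec (CommRingCat.of k))) :
    ((E.thicken n).obj U).left ⟶ Spec (CommRingCat.of (k ⊗[A] S.D n)) :=
  pullback.snd U.hom (stdSpec S k n)

/-- The projection `U ×ₖ D n (k) → Spec D n`. -/
noncomputable def thickenD (n : ℕ) (U : Over (Spec (CommRingCat.of k))) :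
    ((E.thicken n).obj U).left ⟶ Spec (CommRingCat.of (S.D n)) :=
  E.thickenSnd n U ≫ specAlgHom (includeRight : S.D n →ₐ[A] k ⊗[A] S.D n)

theorem thicken_isPullback_std (n : ℕ) (U : Over (Spec (CommRingCat.of k))) :
    IsPullback (E.thickenFst n U) (E.thickenSnd n U) U.hom (stdSpec S k n) :=
  IsPullback.of_hasPullback _ _

theorem thicken_obj_hom (n : ℕ) (U : Over (Spec (CommRingCat.of k))) :
    ((E.thicken n).obj U).hom = E.thickenSnd n U ≫ E.expSpec n := rfl

/-- `U ×ₖ D n (k)` is also the product of `U` and `Spec D n` over `A`, so the component in `Spec k`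
is redundant. Identities between thickenings thus reduce to identities of `A`-algebra homomorphisms
among the `S.D n` and their tensor products. -/
theorem thicken_hom_ext {n : ℕ} {U : Over (Spec (CommRingCat.of k))} {W : Scheme.{u}}
    {f g : W ⟶ ((E.thicken n).obj U).left} (h₁ : f ≫ E.thickenFst n U = g ≫ E.thickenFst n U)
    (h₂ : f ≫ E.thickenD n U = g ≫ E.thickenD n U) : f = g := by
  refine (E.thicken_isPullback_std n U).hom_ext h₁ (spec_tensor_hom_ext ?_ ?_)
  · have h := congrArg (fun t => t ≫ U.hom) h₁
    simp only [Category.assoc, (E.thicken_isPullback_std n U).w] at h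
    rw [Category.assoc, Category.assoc]
    exact h
  · rw [Category.assoc, Category.assoc]
    exact h₂

theorem thicken_map_fst (n : ℕ) {U V : Over (Spec (CommRingCat.of k))} (f : U ⟶ V) :
    ((E.thicken n).map f).left ≫ E.thickenFst n V = E.thickenFst n U ≫ f.left :=
  pullback.lift_fst _ _ _

theorem thicken_map_snd (n : ℕ) {U V : Over (Spec (CommRingCat.of k))} (f : U ⟶ V) :
    ((E.thicken n).map f).left ≫ E.thickenSnd n V = E.thickenSnd n U :=
  pullback.lift_snd _ _ _

theorem thicken_map_D (n : ℕ) {U V : Over (Spec (CommRingCat.of k))} (f : U ⟶ V) :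
    ((E.thicken n).map f).left ≫ E.thickenD n V = E.thickenD n U := by
  rw [thickenD, ← Category.assoc, thicken_map_snd, thickenD]

/-- Thickening is a base change. -/
theorem thicken_map_isPullback (n : ℕ) {U V : Over (Spec (CommRingCat.of k))} (f : U ⟶ V) :
    IsPullback (E.thickenFst n U) ((E.thicken n).map f).left f.left (E.thickenFst n V) := by
  refine IsPullback.of_bot ?_ (E.thicken_map_fst n f).symm (E.thicken_isPullback_std n V).flip.flip
  have h := E.thicken_isPullback_std n U
  rw [← E.thicken_map_snd n f, ← Over.w f] at h
  exact h.flip.flip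

theorem thickenD_structure (n : ℕ) (U : Over (Spec (CommRingCat.of k))) :
    E.thickenD n U ≫ Spec.map (CommRingCat.ofHom (algebraMap A (S.D n))) =
      ((E.thicken n).obj U).hom ≫ Spec.map (CommRingCat.ofHom (algebraMap A k)) := by
  rw [thickenD, Category.assoc, specAlgHom_structure, thicken_obj_hom, Category.assoc]
  exact congrArg _ (specAlgHom_structure (E.E n)).symm

theorem thickenFst_structure (n : ℕ) (U : Over (Spec (CommRingCat.of k))) :
    E.thickenFst n U ≫ U.hom ≫ Spec.map (CommRingCat.ofHom (algebraMap A k)) =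
      ((E.thicken n).obj U).hom ≫ Spec.map (CommRingCat.ofHom (algebraMap A k)) := by
  rw [← Category.assoc, (E.thicken_isPullback_std n U).w, Category.assoc, thicken_obj_hom,
    Category.assoc]
  exact congrArg _ ((specAlgHom_structure (includeLeft : k →ₐ[A] k ⊗[A] S.D n)).trans
    (specAlgHom_structure (E.E n)).symm)

theorem thickenπ_fst {m n : ℕ} (h : n ≤ m) (U : Over (Spec (CommRingCat.of k))) :
    (E.thickenπ h U).left ≫ E.thickenFst m U = E.thickenFst n U :=
  pullback.lift_fst _ _ _

theorem thickenπ_D {m n : ℕ} (h : n ≤ m) (U : Over (Spec (CommRingCat.of k))) :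
    (E.thickenπ h U).left ≫ E.thickenD m U = E.thickenD n U ≫ specAlgHom (S.π h) := by
  have e : (E.thickenπ h U).left ≫ E.thickenSnd m U =
      E.thickenSnd n U ≫ specAlgHom (Algebra.TensorProduct.map (AlgHom.id A k) (S.π h)) :=
    pullback.lift_snd _ _ _
  rw [thickenD, thickenD, ← Category.assoc, e, specAlgHom_comp_assoc, specAlgHom_comp_assoc]
  congr 2

/-- The projection `(U ×ₖ D n (k)) ×ₖ D m (k) → Spec D m (D n (k))`. -/
noncomputable def doubleThickenSnd (m n : ℕ) (U : Over (Spec (CommRingCat.of k))) :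
    ((E.thicken m).obj ((E.thicken n).obj U)).left ⟶
      Spec (CommRingCat.of ((k ⊗[A] S.D n) ⊗[A] S.D m)) :=
  E.doubleThickenToSpec m n U

theorem doubleThickenSnd_left (m n : ℕ) (U : Over (Spec (CommRingCat.of k))) :
    E.doubleThickenSnd m n U ≫ specAlgHom
        (includeLeft : k ⊗[A] S.D n →ₐ[A] (k ⊗[A] S.D n) ⊗[A] S.D m) =
      E.thickenFst m ((E.thicken n).obj U) ≫ E.thickenSnd n U :=
  E.doubleThickenToSpec_comp_left m n U

theorem doubleThickenSnd_right (m n : ℕ) (U : Over (Spec (CommRingCat.of k))) :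
    E.doubleThickenSnd m n U ≫ specAlgHom
        (includeRight : S.D m →ₐ[A] (k ⊗[A] S.D n) ⊗[A] S.D m) =
      E.thickenD m ((E.thicken n).obj U) :=
  E.doubleThickenToSpec_comp_right m n U

/-- The projection `(U ×ₖ D n (k)) ×ₖ D m (k) → Spec (D m ⊗ D n)`. -/
noncomputable def doubleThickenD (m n : ℕ) (U : Over (Spec (CommRingCat.of k))) :
    ((E.thicken m).obj ((E.thicken n).obj U)).left ⟶ Spec (CommRingCat.of (S.D m ⊗[A] S.D n)) :=
  E.doubleThickenSnd m n U ≫ specAlgHom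
    ((Algebra.TensorProduct.assoc A A A k (S.D n) (S.D m)).symm.toAlgHom.comp
      ((includeRight : _ →ₐ[A] k ⊗[A] _).comp
        (Algebra.TensorProduct.comm A (S.D m) (S.D n)).toAlgHom))

theorem doubleThickenD_left (m n : ℕ) (U : Over (Spec (CommRingCat.of k))) :
    E.doubleThickenD m n U ≫ specAlgHom (includeLeft : S.D m →ₐ[A] S.D m ⊗[A] S.D n) =
      E.thickenD m ((E.thicken n).obj U) := by
  rw [doubleThickenD, specAlgHom_comp_assoc, ← doubleThickenSnd_right]
  congr 2

theorem doubleThickenD_right (m n : ℕ) (U : Over (Spec (CommRingCat.of k))) :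
    E.doubleThickenD m n U ≫ specAlgHom (includeRight : S.D n →ₐ[A] S.D m ⊗[A] S.D n) =
      E.thickenFst m ((E.thicken n).obj U) ≫ E.thickenD n U := by
  rw [doubleThickenD, specAlgHom_comp_assoc, thickenD, ← Category.assoc, ← doubleThickenSnd_left,
    specAlgHom_comp_assoc]
  congr 2

theorem thickenΔ_fst (m n : ℕ) (U : Over (Spec (CommRingCat.of k))) :
    (E.thickenΔ m n U).left ≫ E.thickenFst (m + n) U =
      E.thickenFst m ((E.thicken n).obj U) ≫ E.thickenFst n U :=
  pullback.lift_fst _ _ _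

theorem thickenΔ_D (m n : ℕ) (U : Over (Spec (CommRingCat.of k))) :
    (E.thickenΔ m n U).left ≫ E.thickenD (m + n) U =
      E.doubleThickenD m n U ≫ specAlgHom (S.Δ m n) := by
  have e : (E.thickenΔ m n U).left ≫ E.thickenSnd (m + n) U =
      E.doubleThickenSnd m n U ≫ specAlgHom (ΔHom S k m n) :=
    pullback.lift_snd _ _ _
  rw [thickenD, ← Category.assoc, e, doubleThickenD, specAlgHom_comp_assoc, specAlgHom_comp_assoc]
  congr 2

theorem thickenΔ_naturality (m n : ℕ) {U V : Over (Spec (CommRingCat.of k))} (f : U ⟶ V) :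
    (E.thicken m).map ((E.thicken n).map f) ≫ E.thickenΔ m n V =
      E.thickenΔ m n U ≫ (E.thicken (m + n)).map f := by
  have hD : ((E.thicken m).map ((E.thicken n).map f)).left ≫ E.doubleThickenD m n V =
      E.doubleThickenD m n U := by
    apply spec_tensor_hom_ext
    · rw [Category.assoc, doubleThickenD_left, doubleThickenD_left, thicken_map_D]
    · rw [Category.assoc, doubleThickenD_right, doubleThickenD_right, ← Category.assoc,
        thicken_map_fst, Category.assoc, thicken_map_D]
  apply Over.OverMorphism.ext
  apply E.thicken_hom_ext
  · simp only [Over.comp_left, Category.assoc, thickenΔ_fst, thicken_map_fst]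
    rw [← Category.assoc, thicken_map_fst, Category.assoc, thicken_map_fst, ← Category.assoc,
      ← Category.assoc, thickenΔ_fst]
  · simp only [Over.comp_left, Category.assoc, thickenΔ_D, thicken_map_D]
    rw [← Category.assoc, hD]

theorem thickenπ_naturality {m n : ℕ} (h : n ≤ m) {U V : Over (Spec (CommRingCat.of k))}
    (f : U ⟶ V) :
    (E.thicken n).map f ≫ E.thickenπ h V = E.thickenπ h U ≫ (E.thicken m).map f := by
  apply Over.OverMorphism.ext
  apply E.thicken_hom_ext
  · simp only [Over.comp_left, Category.assoc, thickenπ_fst, thicken_map_fst]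
    rw [← Category.assoc, thickenπ_fst]
  · simp only [Over.comp_left, Category.assoc, thickenπ_D, thicken_map_D]
    rw [← Category.assoc, thicken_map_D]

theorem thickenπ_refl (n : ℕ) (U : Over (Spec (CommRingCat.of k))) :
    E.thickenπ (le_refl n) U = 𝟙 _ := by
  apply Over.OverMorphism.ext
  apply E.thicken_hom_ext
  · rw [thickenπ_fst, Over.id_left, Category.id_comp]
  · rw [thickenπ_D, Over.id_left, Category.id_comp, S.π_self, specAlgHom_id, Category.comp_id]

theorem thickenπ_trans {l m n : ℕ} (h : n ≤ m) (h' : m ≤ l) (U : Over (Spec (CommRingCat.of k))) :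
    E.thickenπ h U ≫ E.thickenπ h' U = E.thickenπ (h.trans h') U := by
  apply Over.OverMorphism.ext
  apply E.thicken_hom_ext
  · rw [thickenπ_fst, Over.comp_left, Category.assoc, thickenπ_fst, thickenπ_fst]
  · rw [thickenπ_D, Over.comp_left, Category.assoc, thickenπ_D, ← Category.assoc, thickenπ_D,
      specAlgHom_comp_assoc, S.π_comp]

/-- Compatibility of `Δ` and `π`. -/
theorem thickenΔ_π {m n m' n' : ℕ} (hm : m' ≤ m) (hn : n' ≤ n)
    (U : Over (Spec (CommRingCat.of k))) :
    (E.thicken m').map (E.thickenπ hn U) ≫ E.thickenπ hm ((E.thicken n).obj U) ≫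
      E.thickenΔ m n U = E.thickenΔ m' n' U ≫ E.thickenπ (add_le_add hm hn) U := by
  have hD : ((E.thicken m').map (E.thickenπ hn U)).left ≫
      (E.thickenπ hm ((E.thicken n).obj U)).left ≫ E.doubleThickenD m n U =
      E.doubleThickenD m' n' U ≫ specAlgHom (Algebra.TensorProduct.map (S.π hm) (S.π hn)) := by
    apply spec_tensor_hom_ext
    · rw [specAlgHom_comp_assoc, Algebra.TensorProduct.map_comp_includeLeft, ← specAlgHom_comp,
        ← Category.assoc (E.doubleThickenD m' n' U), doubleThickenD_left, Category.assoc,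
        Category.assoc, doubleThickenD_left, thickenπ_D, ← Category.assoc, thicken_map_D]
    · rw [specAlgHom_comp_assoc, Algebra.TensorProduct.map_comp_includeRight, ← specAlgHom_comp,
        ← Category.assoc (E.doubleThickenD m' n' U), doubleThickenD_right, Category.assoc,
        Category.assoc, doubleThickenD_right, ← Category.assoc (E.thickenπ hm _).left,
        thickenπ_fst, ← Category.assoc, thicken_map_fst, Category.assoc, Category.assoc,
        thickenπ_D]
  apply Over.OverMorphism.ext
  apply E.thicken_hom_ext
  · simp only [Over.comp_left, Category.assoc, thickenΔ_fst, thickenπ_fst]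
    rw [← Category.assoc (E.thickenπ hm _).left, thickenπ_fst, ← Category.assoc, thicken_map_fst,
      Category.assoc, thickenπ_fst]
  · simp only [Over.comp_left, Category.assoc, thickenΔ_D, thickenπ_D]
    rw [← Category.assoc (E.thickenΔ m' n' U).left, thickenΔ_D, specAlgHom_comp_assoc, ← S.Δ_π hm hn,
      ← specAlgHom_comp, ← Category.assoc (E.doubleThickenD m' n' U), ← hD]
    simp only [Category.assoc]

/-- Associativity of `Δ`. -/
theorem thickenΔ_assoc (l m n : ℕ) (U : Over (Spec (CommRingCat.of k))) :
    (E.thicken l).map (E.thickenΔ m n U) ≫ E.thickenΔ l (m + n) U =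
      E.thickenΔ l m ((E.thicken n).obj U) ≫ E.thickenΔ (l + m) n U ≫
        E.thickenπ (add_assoc l m n).le U := by
  -- `t` is the projection of the triple thickening to `Spec (D l ⊗ (D m ⊗ D n))`. Both sides of the
  -- identity factor through it, and `S.Δ_assoc` compares them there.
  obtain ⟨t, ht₁, ht₂⟩ := exists_spec_tensor_lift
    (E.thickenD l ((E.thicken m).obj ((E.thicken n).obj U)))
    (E.thickenFst l ((E.thicken m).obj ((E.thicken n).obj U)) ≫ E.doubleThickenD m n U) (by
      rw [thickenD_structure, ← thickenFst_structure, ← thickenD_structure, ← doubleThickenD_left]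
      simp only [Category.assoc, specAlgHom_structure])
  have h₁ : ((E.thicken l).map (E.thickenΔ m n U)).left ≫ E.doubleThickenD l (m + n) U =
      t ≫ specAlgHom (Algebra.TensorProduct.map (AlgHom.id A (S.D l)) (S.Δ m n)) := by
    apply spec_tensor_hom_ext
    · rw [specAlgHom_comp_assoc, Algebra.TensorProduct.map_comp_includeLeft, AlgHom.comp_id,
        ht₁, Category.assoc, doubleThickenD_left, thicken_map_D]
    · rw [specAlgHom_comp_assoc, Algebra.TensorProduct.map_comp_includeRight, ← specAlgHom_comp,
        ← Category.assoc t, ht₂, Category.assoc, doubleThickenD_right, ← Category.assoc,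
        thicken_map_fst, Category.assoc, Category.assoc, thickenΔ_D]
  have h₂ : t ≫ specAlgHom ((Algebra.TensorProduct.assoc A A A (S.D l) (S.D m) (S.D n)).toAlgHom.comp
      includeLeft) = E.doubleThickenD l m ((E.thicken n).obj U) := by
    apply spec_tensor_hom_ext
    · rw [doubleThickenD_left, specAlgHom_comp_assoc, ← ht₁]
      congr 2
    · rw [doubleThickenD_right, specAlgHom_comp_assoc, ← doubleThickenD_left, ← Category.assoc,
        ← ht₂, specAlgHom_comp_assoc]
      congr 2
  have h₃ : (E.thickenΔ l m ((E.thicken n).obj U)).left ≫ E.doubleThickenD (l + m) n U =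
      t ≫ specAlgHom ((Algebra.TensorProduct.assoc A A A (S.D l) (S.D m) (S.D n)).toAlgHom.comp
        (Algebra.TensorProduct.map (S.Δ l m) (AlgHom.id A (S.D n)))) := by
    apply spec_tensor_hom_ext
    · rw [specAlgHom_comp_assoc, AlgHom.comp_assoc, Algebra.TensorProduct.map_comp_includeLeft,
        ← AlgHom.comp_assoc, ← specAlgHom_comp, ← Category.assoc t, h₂, Category.assoc,
        doubleThickenD_left, thickenΔ_D]
    · rw [specAlgHom_comp_assoc, Category.assoc, doubleThickenD_right, ← Category.assoc,
        thickenΔ_fst, Category.assoc, ← doubleThickenD_right, ← Category.assoc, ← ht₂,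
        specAlgHom_comp_assoc]
      congr 2
      ext x
      simp [Algebra.TensorProduct.one_def]
  apply Over.OverMorphism.ext
  apply E.thicken_hom_ext
  · simp only [Over.comp_left, Category.assoc, thickenΔ_fst, thickenπ_fst]
    rw [← Category.assoc, thicken_map_fst, Category.assoc, thickenΔ_fst, ← Category.assoc,
      ← Category.assoc, thickenΔ_fst]
  · simp only [Over.comp_left, Category.assoc, thickenΔ_D, thickenπ_D]
    rw [← Category.assoc, h₁, specAlgHom_comp_assoc, S.Δ_assoc,
      ← Category.assoc (E.thickenΔ (l + m) n U).left, thickenΔ_D, specAlgHom_comp_assoc,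
      ← Category.assoc, h₃, specAlgHom_comp_assoc]

end IterativeHasseSchmidtRing

/-! ### Scheme-theoretically dominant morphisms and descent of morphisms. -/

namespace AlgebraicGeometry

/-- A scheme-theoretically dominant morphism lifts uniquely against closed immersions. -/
theorem exists_lift_of_isSchemeTheoreticallyDominant {P Q Z Y : Scheme.{u}} (f : P ⟶ Q)
    [IsSchemeTheoreticallyDominant f] (i : Z ⟶ Y) [IsClosedImmersion i] (a : P ⟶ Z) (b : Q ⟶ Y)
    (h : a ≫ i = f ≫ b) : ∃ c : Q ⟶ Z, c ≫ i = b ∧ f ≫ c = a := by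
  have hk : i.ker ≤ b.ker := by
    have h₁ : (f ≫ b).ker = b.ker := by
      rw [Scheme.Hom.ker_comp, f.ker_eq_bot, Scheme.IdealSheafData.map_bot]
    rw [← h₁, ← h]
    exact Scheme.Hom.le_ker_comp a i
  refine ⟨IsClosedImmersion.lift i b hk, IsClosedImmersion.lift_fac _ _ _, ?_⟩
  rw [← cancel_mono i, Category.assoc, IsClosedImmersion.lift_fac, h]

/-- Scheme-theoretically dominant morphisms are epimorphisms for separated targets. -/
theorem eq_of_isSchemeTheoreticallyDominant {P Q X S : Scheme.{u}} (f : P ⟶ Q)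
    [IsSchemeTheoreticallyDominant f] (g : X ⟶ S) [IsSeparated g] {u v : Q ⟶ X}
    (hg : u ≫ g = v ≫ g) (h : f ≫ u = f ≫ v) : u = v := by
  -- The diagonal of a separated morphism is a closed immersion, and `(u, v)` lifts to it because it
  -- does so after `f`.
  obtain ⟨c, hc, -⟩ := exists_lift_of_isSchemeTheoreticallyDominant f (pullback.diagonal g)
    (f ≫ u) (pullback.lift u v hg) (by
      apply pullback.hom_ext
      · rw [Category.assoc, Category.assoc, Category.assoc, pullback.lift_fst,
          pullback.diagonal_fst, Category.comp_id]
      · rw [Category.assoc, Category.assoc, Category.assoc, pullback.lift_snd,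
          pullback.diagonal_snd, Category.comp_id, h])
  have h₁ := congrArg (fun t => t ≫ pullback.fst g g) hc
  have h₂ := congrArg (fun t => t ≫ pullback.snd g g) hc
  simp only [Category.assoc, pullback.diagonal_fst, pullback.diagonal_snd, Category.comp_id,
    pullback.lift_fst, pullback.lift_snd] at h₁ h₂
  rw [← h₁, ← h₂]

/-- A homomorphism whose image lies in that of an injective homomorphism factors through it. -/
theorem exists_ringHom_factor {R B C : Type*} [CommRing R] [CommRing B] [CommRing C] (t : R →+* C)
    (f : B →+* C) (hf : Function.Injective f) (h : ∀ r, ∃ b, f b = t r) :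
    ∃ θ : R →+* B, f.comp θ = t := by
  choose θ hθ using h
  refine ⟨{ toFun := θ, map_one' := hf ?_, map_zero' := hf ?_, map_mul' := fun x y => hf ?_,
            map_add' := fun x y => hf ?_ }, ?_⟩
  · simp [hθ]
  · simp [hθ]
  · simp [hθ]
  · simp [hθ]
  · ext x
    exact hθ x

/-- Let `P → Q` be universally closed morphism of affine schemes, `Q' → Q` a morphism such that
functions on `P` that come from `Q'` come from `Q`. Then a morphism from `P` to a separated scheme
that is equalized by the two projections of `P ×_Q P` and descends over `Q'` descends to `Q`. -/
theorem exists_descent_of_cartesian {P Q P' Q' X S : Scheme.{u}} [IsAffine P] [IsAffine Q]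
    (f : P ⟶ Q) (f' : P' ⟶ Q') (a : P' ⟶ P) (b : Q' ⟶ Q)
    (comm : a ≫ f = f' ≫ b) [UniversallyClosed f] [IsSchemeTheoreticallyDominant f']
    (hf : Function.Injective f.appTop)
    (hcart : ∀ (x : Γ(P, ⊤)) (y : Γ(Q', ⊤)), a.appTop x = f'.appTop y → ∃ z, f.appTop z = x)
    (g : X ⟶ S) [IsSeparated g] (q : Q ⟶ S) (φ : P ⟶ X) (hφ : φ ≫ g = f ≫ q)
    (hdesc : pullback.fst f f ≫ φ = pullback.snd f f ≫ φ)
    (ψ' : Q' ⟶ X) (hψ' : ψ' ≫ g = b ≫ q) (hagree : f' ≫ ψ' = a ≫ φ) :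
    ∃ ψ : Q ⟶ X, f ≫ ψ = φ := by
  -- `γ` is the graph of `φ` relative to `Q`. Its scheme-theoretic image is the candidate for the
  -- graph of the descended morphism.
  let γ : P ⟶ pullback q g := pullback.lift f φ hφ.symm
  let γ' : Q' ⟶ pullback q g := pullback.lift b ψ' hψ'.symm
  have hγf : γ ≫ pullback.fst q g = f := pullback.lift_fst _ _ _
  have hγφ : γ ≫ pullback.snd q g = φ := pullback.lift_snd _ _ _
  have hγγ' : a ≫ γ = f' ≫ γ' := by
    apply pullback.hom_ext
    · rw [Category.assoc, Category.assoc, pullback.lift_fst, pullback.lift_fst, comm]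
    · rw [Category.assoc, Category.assoc, pullback.lift_snd, pullback.lift_snd, hagree]
  have hγuc : UniversallyClosed γ := by
    have : UniversallyClosed (γ ≫ pullback.fst q g) := by rw [hγf]; infer_instance
    exact .of_comp_of_isSeparated γ (pullback.fst q g)
  let t := γ.toImage
  let j := γ.imageι
  have htj : t ≫ j = γ := γ.toImage_imageι
  have htuc : UniversallyClosed t := by
    have : UniversallyClosed (t ≫ j) := by rw [htj]; infer_instance
    exact .of_comp_of_isSeparated t j
  have htd : IsDominant t := inferInstanceAs (IsDominant γ.toImage)
  have hts : Surjective t := by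
    refine ⟨fun x => ?_⟩
    have h₁ : IsClosed (Set.range t) := t.isClosedMap.isClosed_range
    have h₂ := t.denseRange.closure_eq
    rw [h₁.closure_eq] at h₂
    exact h₂.ge (Set.mem_univ x)
  let w := j ≫ pullback.fst q g
  have htw : t ≫ w = f := by rw [← Category.assoc, htj, hγf]
  have hwuc : UniversallyClosed w := by
    have : UniversallyClosed (t ≫ w) := by rw [htw]; infer_instance
    exact .of_comp_surjective t w
  -- Two points of `P` over the same point of `Q` come from a point of `P ×_Q P`, on which the two
  -- projections agree after `t`.
  have hwinj : Function.Injective w := by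
    intro x₁ x₂ hx
    obtain ⟨p₁, rfl⟩ := t.surjective x₁
    obtain ⟨p₂, rfl⟩ := t.surjective x₂
    have hp : f p₁ = f p₂ := by
      rw [← htw]
      exact hx
    obtain ⟨z, rfl, rfl⟩ := Scheme.Pullback.exists_preimage_pullback p₁ p₂ hp
    rw [← Scheme.Hom.comp_apply, ← Scheme.Hom.comp_apply]
    congr 1
    have h : pullback.fst f f ≫ t = pullback.snd f f ≫ t := by
      rw [← cancel_mono j, Category.assoc, Category.assoc, htj]
      apply pullback.hom_ext
      · rw [Category.assoc, Category.assoc, hγf, pullback.condition]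
      · rw [Category.assoc, Category.assoc, hγφ, hdesc]
    rw [h]
  have hwce : Topology.IsClosedEmbedding w :=
    .of_continuous_injective_isClosedMap w.continuous hwinj w.isClosedMap
  -- A closed topological embedding is an affine morphism, so the image is affine although `X` is
  -- not.
  have hwa : IsAffineHom w := isAffineHom_of_isInducing w hwce.isInducing hwce.isClosed_range
  have hW : IsAffine γ.image := isAffine_of_isAffineHom w
  obtain ⟨c, hcj, hfc⟩ := exists_lift_of_isSchemeTheoreticallyDominant f' j (a ≫ t) γ' (by
    rw [Category.assoc, htj, hγγ'])
  -- A function on the image, pulled back to `P` and then to `P'`, comes from `Q'` through `c`; by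
  -- `hcart` it comes from `Q`. This gives a morphism `s` from `Q` to the image, through which `t`
  -- factors.
  obtain ⟨θ, hθ⟩ := exists_ringHom_factor t.appTop.hom f.appTop.hom hf (fun r => by
    refine hcart _ (c.appTop r) ?_
    have h := congrArg (fun s => s.appTop r) hfc
    rw [Scheme.Hom.comp_appTop, Scheme.Hom.comp_appTop] at h
    exact h.symm)
  let s : Q ⟶ γ.image := Q.toSpecΓ ≫ Spec.map (CommRingCat.ofHom θ) ≫ γ.image.isoSpec.inv
  have hs : f ≫ s = t := by
    have hθ' : CommRingCat.ofHom θ ≫ f.appTop = t.appTop := CommRingCat.hom_ext hθ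
    rw [← Category.assoc, Scheme.toSpecΓ_naturality, Category.assoc, ← Spec.map_comp_assoc, hθ',
      ← Category.assoc, ← Scheme.toSpecΓ_naturality, Category.assoc, Scheme.toSpecΓ_isoSpec_inv,
      Category.comp_id]
  refine ⟨s ≫ j ≫ pullback.snd q g, ?_⟩
  rw [← Category.assoc, hs, ← Category.assoc, htj, hγφ]

end AlgebraicGeometry

/-! ### Linear algebra on pushouts of rings. -/

namespace CommRingCat

/-- A pushout of commutative rings is a tensor product, with explicit values on products. -/
theorem exists_ringEquiv_tensorProduct_of_isPushout {R B C P : CommRingCat.{u}} [Algebra R B]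
    [Algebra R C] {i : B ⟶ P} {j : C ⟶ P}
    (h : IsPushout (ofHom (algebraMap R B)) (ofHom (algebraMap R C)) i j) :
    ∃ e : B ⊗[R] C ≃+* P, ∀ b c, e (b ⊗ₜ c) = i b * j c := by
  let e := ((isPushout_tensorProduct R B C).isoIsPushout _ _ h)
  refine ⟨e.commRingCatIsoToRingEquiv, fun b c => ?_⟩
  have h₁ : ∀ b, e.hom (b ⊗ₜ[R] (1 : C)) = i b := fun b =>
    congr($((isPushout_tensorProduct R B C).inl_isoIsPushout_hom _ _ h) b)
  have h₂ : ∀ c, e.hom ((1 : B) ⊗ₜ[R] c) = j c := fun c =>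
    congr($((isPushout_tensorProduct R B C).inr_isoIsPushout_hom _ _ h) c)
  have h₃ : b ⊗ₜ[R] c = (b ⊗ₜ[R] (1 : C)) * ((1 : B) ⊗ₜ[R] c) := by simp
  rw [h₃, map_mul]
  exact congrArg₂ _ (h₁ b) (h₂ c)

theorem addMonoidHom_ext_of_isPushout {R B C P : CommRingCat.{u}} {s : R ⟶ B} {t : R ⟶ C}
    {i : B ⟶ P} {j : C ⟶ P} (h : IsPushout s t i j) {G : Type*} [AddCommGroup G] {u v : P →+ G}
    (huv : ∀ b c, u (i b * j c) = v (i b * j c)) : u = v := by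
  algebraize [s.hom, t.hom]
  obtain ⟨e, he⟩ := exists_ringEquiv_tensorProduct_of_isPushout (R := R) (B := B) (C := C) h
  ext x
  obtain ⟨y, rfl⟩ := e.surjective x
  induction y with
  | zero => simp
  | tmul b c => rw [he, huv]
  | add y z hy hz => rw [map_add, map_add, map_add, hy, hz]

/-- This is `id ⊗ ρ`. It is needed for retractions `ρ` that are linear but not multiplicative, which
the universal property of pushouts of rings does not reach. -/
theorem exists_addMonoidHom_of_isPushout {R B C P C' P' : CommRingCat.{u}} {s : R ⟶ B} {t : R ⟶ C}
    {i : B ⟶ P} {j : C ⟶ P} (h : IsPushout s t i j) {t' : R ⟶ C'} {i' : B ⟶ P'} {j' : C' ⟶ P'}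
    (h' : IsPushout s t' i' j') (ρ : C →+ C') (hρ : ∀ r c, ρ (t r * c) = t' r * ρ c) :
    ∃ σ : P →+ P', ∀ b c, σ (i b * j c) = i' b * j' (ρ c) := by
  algebraize [s.hom, t.hom, t'.hom]
  obtain ⟨e, he⟩ := exists_ringEquiv_tensorProduct_of_isPushout (R := R) (B := B) (C := C) h
  obtain ⟨e', he'⟩ := exists_ringEquiv_tensorProduct_of_isPushout (R := R) (B := B) (C := C') h'
  let ρ' : C →ₗ[R] C' := 
    { ρ with
      map_smul' := fun r c => by
        change ρ (r • c) = r • ρ c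
        simp only [Algebra.smul_def]
        exact hρ r c }
  refine ⟨e'.toAddMonoidHom.comp ((ρ'.lTensor B).toAddMonoidHom.comp e.symm.toAddMonoidHom),
    fun b c => ?_⟩
  rw [← he, ← he']
  simp
  rfl

/-- Linear algebra over a field: for an injection `C₀ → C` of algebras over a field and an
injection `B → B'`, the intersection of `B ⊗ C` and `B' ⊗ C₀` in `B' ⊗ C` is `B ⊗ C₀`. -/
theorem exists_preimage_of_isPushout {R B B' C C₀ P P₀ P' P₀' : CommRingCat.{u}} (hR : IsField R)
    {s : R ⟶ B} {b : B ⟶ B'} {t : R ⟶ C₀} {f₀ : C₀ ⟶ C} (hf₀ : Function.Injective f₀)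
    {i₀ : B ⟶ P₀} {j₀ : C₀ ⟶ P₀} (h₀ : IsPushout s t i₀ j₀)
    {i : B ⟶ P} {j : C ⟶ P} (h : IsPushout s (t ≫ f₀) i j)
    {i₀' : B' ⟶ P₀'} {j₀' : C₀ ⟶ P₀'} (h₀' : IsPushout (s ≫ b) t i₀' j₀')
    {i' : B' ⟶ P'} {j' : C ⟶ P'} (h' : IsPushout (s ≫ b) (t ≫ f₀) i' j')
    {f : P₀ ⟶ P} (hf₁ : i₀ ≫ f = i) (hf₂ : j₀ ≫ f = f₀ ≫ j)
    {f' : P₀' ⟶ P'} (hf'₁ : i₀' ≫ f' = i') (hf'₂ : j₀' ≫ f' = f₀ ≫ j')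
    {a : P ⟶ P'} (ha₁ : i ≫ a = b ≫ i') (ha₂ : j ≫ a = j') (ha : Function.Injective a)
    (x : P) (y : P₀') (hxy : a x = f' y) : ∃ z, f z = x := by
  let := hR.toField
  algebraize [t.hom, f₀.hom, f₀.hom.comp t.hom]
  let F : C₀ →ₗ[R] C := (Algebra.ofId C₀ C).toLinearMap.restrictScalars R
  -- Here the base must be a field: `f₀` gets an `R`-linear retraction `ρ`, whose base changes to
  -- `B` and `B'` are `σ` and `σ'`.
  obtain ⟨ρ, hρ⟩ := F.exists_leftInverse_of_injective (LinearMap.ker_eq_bot.mpr hf₀)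
  have hρ₀ : ∀ c, ρ (f₀ c) = c := fun c => congr($hρ c)
  have hρ₁ : ∀ r c, ρ.toAddMonoidHom ((t ≫ f₀) r * c) = t r * ρ.toAddMonoidHom c := fun r c => by
    have := ρ.map_smul r c
    simp only [Algebra.smul_def] at this
    exact this
  obtain ⟨σ, hσ⟩ := exists_addMonoidHom_of_isPushout h h₀ ρ.toAddMonoidHom hρ₁
  obtain ⟨σ', hσ'⟩ := exists_addMonoidHom_of_isPushout h' h₀' ρ.toAddMonoidHom hρ₁
  have hf₁' : ∀ z, f (i₀ z) = i z := fun z => congr($hf₁ z)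
  have hf₂' : ∀ z, f (j₀ z) = j (f₀ z) := fun z => congr($hf₂ z)
  have hf'₁' : ∀ z, f' (i₀' z) = i' z := fun z => congr($hf'₁ z)
  have hf'₂' : ∀ z, f' (j₀' z) = j' (f₀ z) := fun z => congr($hf'₂ z)
  have ha₁' : ∀ z, a (i z) = i' (b z) := fun z => congr($ha₁ z)
  have ha₂' : ∀ z, a (j z) = j' z := fun z => congr($ha₂ z)
  have e₁ : σ'.comp f'.hom.toAddMonoidHom = AddMonoidHom.id _ := by
    apply addMonoidHom_ext_of_isPushout h₀'
    intro u v
    change σ' (f' (i₀' u * j₀' v)) = i₀' u * j₀' v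
    rw [map_mul, hf'₁', hf'₂', hσ']
    exact congrArg _ (congrArg _ (hρ₀ v))
  have e₂ : (a.hom.toAddMonoidHom.comp f.hom.toAddMonoidHom).comp σ =
      (f'.hom.toAddMonoidHom.comp σ').comp a.hom.toAddMonoidHom := by
    apply addMonoidHom_ext_of_isPushout h
    intro u v
    change a (f (σ (i u * j v))) = f' (σ' (a (i u * j v)))
    rw [hσ, map_mul, map_mul, map_mul, hf₁', hf₂', ha₁', ha₂', ha₂', hσ', map_mul, hf'₁',
      hf'₂']
  -- Under `a`, `f (σ x)` becomes `f' (σ' (a x)) = f' (σ' (f' y)) = f' y = a x`.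
  refine ⟨σ x, ha ?_⟩
  have e₃ : a (f (σ x)) = f' (σ' (a x)) := congr($e₂ x)
  have e₄ : σ' (f' y) = y := congr($e₁ y)
  rw [e₃, hxy, e₄]

end CommRingCat

/-! ### Descent over `O` of a morphism already descended over a dense `K → O`. -/

namespace AlgebraicGeometry

/-- Descent along the base change to `O` of a surjection `P₀ → Q₀` of finite schemes over a field,
for morphisms that descend over a scheme-theoretically dense `K → O`. -/
theorem exists_descent_of_isSchemeTheoreticallyDominant {k : Type u} [Field k]
    {P₀ Q₀ O K P Q P' Q' X S : Scheme.{u}}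
    [IsAffine P₀] [IsAffine Q₀] [IsAffine O] [IsAffine K] [S.IsSeparated]
    {f₀ : P₀ ⟶ Q₀} {q₀ : Q₀ ⟶ Spec (CommRingCat.of k)} [IsSchemeTheoreticallyDominant f₀]
    [UniversallyClosed (f₀ ≫ q₀)] {s : O ⟶ Spec (CommRingCat.of k)} {c : K ⟶ O}
    [IsSchemeTheoreticallyDominant c]
    {sQ : Q ⟶ O} {iQ : Q ⟶ Q₀} (hQ : IsPullback sQ iQ s q₀)
    {f : P ⟶ Q} {iP : P ⟶ P₀} (hP : IsPullback f iP iQ f₀)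
    {sQ' : Q' ⟶ K} {b : Q' ⟶ Q} (hQ' : IsPullback sQ' b c sQ)
    {f' : P' ⟶ Q'} {a : P' ⟶ P} (hP' : IsPullback f' a b f)
    (g : X ⟶ S) [IsSeparated g] (q : Q ⟶ S) (φ : P ⟶ X) (hφ : φ ≫ g = f ≫ q)
    (ψ' : Q' ⟶ X) (hψ' : ψ' ≫ g = b ≫ q) (hagree : f' ≫ ψ' = a ≫ φ) :
    ∃ ψ : Q ⟶ X, ψ ≫ g = q ∧ f ≫ ψ = φ ∧ b ≫ ψ = ψ' := by
  have hPO : IsPullback (f ≫ sQ) iP s (f₀ ≫ q₀) := hP.paste_horiz hQ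
  have hQK : IsPullback sQ' (b ≫ iQ) (c ≫ s) q₀ := hQ'.paste_vert hQ
  have hPQ' : IsPullback f' (a ≫ iP) (b ≫ iQ) f₀ := hP'.paste_vert hP
  have hPK : IsPullback (f' ≫ sQ') (a ≫ iP) (c ≫ s) (f₀ ≫ q₀) := hPQ'.paste_horiz hQK
  have hPc : IsPullback (f' ≫ sQ') a c (f ≫ sQ) := hP'.paste_horiz hQ'
  have : IsAffine Q := .of_isPullback hQ
  have : IsAffine P := .of_isPullback hPO
  have : IsAffine Q' := .of_isPullback hQK
  have : IsAffine P' := .of_isPullback hPK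
  have : Flat s := inferInstance
  have : Flat iQ := MorphismProperty.of_isPullback hQ ‹Flat s›
  have : Flat (b ≫ iQ) := MorphismProperty.of_isPullback hQK (inferInstanceAs (Flat (c ≫ s)))
  have : Flat (f ≫ sQ) := MorphismProperty.of_isPullback hPO.flip inferInstance
  have hfd : IsSchemeTheoreticallyDominant f := .of_isPullback hP.flip
  have hfd' : IsSchemeTheoreticallyDominant f' := .of_isPullback hPQ'.flip
  have had : IsSchemeTheoreticallyDominant a := .of_isPullback hPc
  have hfuc : UniversallyClosed f := by
    have : UniversallyClosed (f ≫ sQ) := MorphismProperty.of_isPullback hPO.flip inferInstance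
    exact .of_comp_of_isSeparated f sQ
  -- `P ×_Q P` is a base change of `P₀ ×_{Q₀} P₀`, hence flat over `O`, so its restriction to `K` is
  -- still scheme-theoretically dense. There `φ` comes from `ψ'` and the two projections agree.
  have hdesc : pullback.fst f f ≫ φ = pullback.snd f f ≫ φ := by
    have h₁ : IsPullback (pullback.snd f f ≫ iP) (pullback.fst f f) f₀ (iP ≫ f₀) := by
      rw [← hP.w]
      exact ((IsPullback.of_hasPullback f f).paste_vert hP.flip.flip).flip
    have h₂ := (IsPullback.of_right' h₁ (IsPullback.of_hasPullback f₀ f₀).flip).paste_vert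
      hPO.flip
    have : Flat (pullback.fst f f ≫ f ≫ sQ) := MorphismProperty.of_isPullback h₂ inferInstance
    let h := pullback.fst f f ≫ f ≫ sQ
    have hw₁ : pullback.snd h c ≫ c = (pullback.fst h c ≫ pullback.fst f f) ≫ f ≫ sQ := by
      rw [← pullback.condition, Category.assoc]
    have hw₂ : pullback.snd h c ≫ c = (pullback.fst h c ≫ pullback.snd f f) ≫ f ≫ sQ := by
      rw [hw₁, Category.assoc, Category.assoc, pullback.condition_assoc]
    have hx : hPc.lift _ _ hw₁ ≫ f' = hPc.lift _ _ hw₂ ≫ f' := by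
      apply hQ'.hom_ext
      · rw [Category.assoc, Category.assoc, hPc.lift_fst, hPc.lift_fst]
      · rw [Category.assoc, Category.assoc, hP'.w, hPc.lift_snd_assoc, hPc.lift_snd_assoc,
          Category.assoc, Category.assoc, pullback.condition]
    refine eq_of_isSchemeTheoreticallyDominant (pullback.fst h c) g ?_ ?_
    · rw [Category.assoc, Category.assoc, hφ, pullback.condition_assoc]
    · have e₁ := hPc.lift_snd_assoc _ _ hw₁ φ
      have e₂ := hPc.lift_snd_assoc _ _ hw₂ φ
      rw [← Category.assoc, ← Category.assoc, ← e₁, ← e₂, ← hagree, ← Category.assoc, hx,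
        Category.assoc]
  have hR : IsField Γ(Spec (CommRingCat.of k), ⊤) :=
    (Scheme.ΓSpecIso (CommRingCat.of k)).commRingCatIsoToRingEquiv.toMulEquiv.isField
      (Field.toIsField k)
  have hcart : ∀ (x : Γ(P, ⊤)) (y : Γ(Q', ⊤)), a.appTop x = f'.appTop y →
      ∃ z, f.appTop z = x := by
    intro x y hxy
    have e₀ := isPushout_appTop_of_isPullback hQ
    have e := isPushout_appTop_of_isPullback hPO
    have e₀' := isPushout_appTop_of_isPullback hQK
    have e' := isPushout_appTop_of_isPullback hPK
    rw [Scheme.Hom.comp_appTop f₀ q₀] at e e'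
    rw [Scheme.Hom.comp_appTop c s] at e₀' e'
    refine CommRingCat.exists_preimage_of_isPushout hR (f₀ := f₀.appTop)
      (f₀.app_injective ⊤) e₀ e e₀' e'
      (f := f.appTop) ?_ ?_ (f' := f'.appTop) ?_ ?_ (a := a.appTop) ?_ ?_ (a.app_injective ⊤)
      x y hxy
    · rw [← Scheme.Hom.comp_appTop]
    · rw [← Scheme.Hom.comp_appTop, ← Scheme.Hom.comp_appTop, hP.w]
    · rw [← Scheme.Hom.comp_appTop]
    · rw [← Scheme.Hom.comp_appTop, ← Scheme.Hom.comp_appTop, hPQ'.w]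
    · rw [← Scheme.Hom.comp_appTop, ← Scheme.Hom.comp_appTop, hPc.w]
    · rw [← Scheme.Hom.comp_appTop]
  obtain ⟨ψ, hψ⟩ := exists_descent_of_cartesian f f' a b hP'.w.symm (f.app_injective ⊤) hcart g q
    φ hφ hdesc ψ' hψ' hagree
  have hψg : ψ ≫ g = q := by
    refine eq_of_isSchemeTheoreticallyDominant f (terminal.from S) (Subsingleton.elim _ _) ?_
    rw [← Category.assoc, hψ, hφ]
  refine ⟨ψ, hψg, hψ, eq_of_isSchemeTheoreticallyDominant f' g ?_ ?_⟩
  · rw [Category.assoc, hψg, hψ']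
  · rw [← Category.assoc, hP'.w, Category.assoc, hψ, hagree]

end AlgebraicGeometry

/-! ### Weil restriction of closed subschemes along finite free morphisms. -/

namespace CommRingCat

/-- The pushout of a free algebra is free on the image of a basis. -/
theorem existsUnique_sum_of_isPushout {R B C P : CommRingCat.{u}} [Algebra R C] {s : R ⟶ B}
    {i : B ⟶ P} {j : C ⟶ P} (h : IsPushout s (ofHom (algebraMap R C)) i j)
    {ι : Type*} [Fintype ι] (c : Module.Basis ι R C) (y : P) :
    ∃! a : ι → B, y = ∑ l, i (a l) * j (c l) := by
  algebraize [s.hom]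
  obtain ⟨e, he⟩ := exists_ringEquiv_tensorProduct_of_isPushout (R := R) (B := B) (C := C) h
  let c' : Module.Basis ι B (B ⊗[R] C) := Algebra.TensorProduct.basis B c
  have hc' : ∀ a : ι → B, e (∑ l, a l • c' l) = ∑ l, i (a l) * j (c l) := fun a => by
    rw [map_sum]
    refine Finset.sum_congr rfl fun l _ => ?_
    rw [Algebra.TensorProduct.basis_apply, ← he, TensorProduct.smul_tmul', smul_eq_mul, mul_one]
  refine ⟨fun l => c'.repr (e.symm y) l, ?_, fun a ha => ?_⟩
  · change y = ∑ l, i (c'.repr (e.symm y) l) * j (c l)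
    rw [← hc', c'.sum_repr, e.apply_symm_apply]
  · funext l
    rw [ha, ← hc', e.symm_apply_apply, c'.repr_sum_self]

end CommRingCat

namespace AlgebraicGeometry

namespace Scheme

section LinComb

variable {X Y X' Y' : Scheme.{u}} {ι : Type*} [Fintype ι]

/-- The linear combination, with coefficients on `V`, of global sections `b`. -/
noncomputable def Hom.linComb (g : Y ⟶ X) (b : ι → Γ(Y, ⊤)) (V : X.Opens) (c : ι → Γ(X, V)) :
    Γ(Y, g ⁻¹ᵁ V) :=
  ∑ l, g.app V (c l) * Y.presheaf.map (homOfLE le_top).op (b l)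

theorem Hom.linComb_zero (g : Y ⟶ X) (b : ι → Γ(Y, ⊤)) (V : X.Opens) :
    g.linComb b V 0 = 0 := by
  simp [Hom.linComb]

theorem Hom.linComb_add (g : Y ⟶ X) (b : ι → Γ(Y, ⊤)) (V : X.Opens) (c d : ι → Γ(X, V)) :
    g.linComb b V (c + d) = g.linComb b V c + g.linComb b V d := by
  simp [Hom.linComb, add_mul, Finset.sum_add_distrib]

theorem Hom.linComb_smul (g : Y ⟶ X) (b : ι → Γ(Y, ⊤)) (V : X.Opens) (a : Γ(X, V))
    (c : ι → Γ(X, V)) : g.linComb b V (a • c) = g.app V a * g.linComb b V c := by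
  simp [Hom.linComb, Finset.mul_sum, mul_assoc]

theorem Hom.linComb_appLE {g : Y ⟶ X} {Φ : Y' ⟶ Y} {g' : Y' ⟶ X'} {φ : X' ⟶ X}
    (w : Φ ≫ g = g' ≫ φ) (b : ι → Γ(Y, ⊤)) (V : X.Opens) (V' : X'.Opens) (hV : V' ≤ φ ⁻¹ᵁ V)
    (hV' : g' ⁻¹ᵁ V' ≤ Φ ⁻¹ᵁ g ⁻¹ᵁ V) (c : ι → Γ(X, V)) :
    Φ.appLE (g ⁻¹ᵁ V) (g' ⁻¹ᵁ V') hV' (g.linComb b V c) =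
      g'.linComb (fun l => Φ.appTop (b l)) V' (fun l => φ.appLE V V' hV (c l)) := by
  have h₁ : g.app V ≫ Φ.appLE (g ⁻¹ᵁ V) (g' ⁻¹ᵁ V') hV' = φ.appLE V V' hV ≫ g'.app V' := by
    refine (Hom.comp_appLE Φ g V _ hV').symm.trans ?_
    rw [g'.app_eq_appLE, Hom.appLE_comp_appLE]
    congr 1
  have h₂ : Y.presheaf.map (homOfLE le_top).op ≫ Φ.appLE (g ⁻¹ᵁ V) (g' ⁻¹ᵁ V') hV' =
      Φ.appTop ≫ Y'.presheaf.map (homOfLE le_top).op := by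
    rw [Hom.map_appLE]
    rfl
  rw [Hom.linComb, Hom.linComb, map_sum]
  refine Finset.sum_congr rfl fun l _ => ?_
  rw [map_mul]
  exact congrArg₂ _ congr($h₁ (c l)) congr($h₂ (b l))

theorem Hom.linComb_map (g : Y ⟶ X) (b : ι → Γ(Y, ⊤)) {V V' : X.Opens} (h : V' ≤ V)
    (c : ι → Γ(X, V)) :
    Y.presheaf.map (homOfLE (g.preimage_mono h)).op (g.linComb b V c) =
      g.linComb b V' (fun l => X.presheaf.map (homOfLE h).op (c l)) := by
  have h₁ := Hom.linComb_appLE (g := g) (Φ := 𝟙 Y) (g' := g) (φ := 𝟙 X) (by simp) b V V' h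
    (g.preimage_mono h) c
  have h₂ : (𝟙 Y : Y ⟶ Y).appLE (g ⁻¹ᵁ V) (g ⁻¹ᵁ V') (g.preimage_mono h) =
      Y.presheaf.map (homOfLE (g.preimage_mono h)).op := by
    simp only [Hom.appLE, Hom.id_app]
    exact Category.id_comp _
  have h₃ : (𝟙 X : X ⟶ X).appLE V V' h = X.presheaf.map (homOfLE h).op := by
    simp only [Hom.appLE, Hom.id_app]
    exact Category.id_comp _
  rw [h₂, h₃] at h₁
  exact h₁

/-- The global sections `b` of `Y` form a basis of its functions over the functions of `X`. -/
def Hom.IsFreeOn (g : Y ⟶ X) (b : ι → Γ(Y, ⊤)) : Prop :=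
  ∀ V : X.affineOpens, ∀ y : Γ(Y, g ⁻¹ᵁ V), ∃! c : ι → Γ(X, V), y = g.linComb b V c

/-- Freeness is only known over affine opens, but vanishing of coefficients is local. The general
open is needed because preimages of affine opens under an arbitrary morphism need not be affine. -/
theorem Hom.IsFreeOn.eq_zero {g : Y ⟶ X} {b : ι → Γ(Y, ⊤)} (h : g.IsFreeOn b) (V : X.Opens)
    {c : ι → Γ(X, V)} (hc : g.linComb b V c = 0) : c = 0 := by
  funext l
  refine X.IsSheaf.section_ext fun x hx => ?_
  obtain ⟨_, ⟨W, hW, rfl⟩, hxW, hWV : W ≤ V⟩ :=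
    X.isBasis_affineOpens.exists_subset_of_mem_open hx V.isOpen
  refine ⟨W, hWV, hxW, ?_⟩
  have h₁ := Hom.linComb_map g b hWV c
  rw [hc, map_zero] at h₁
  have h₂ := (h ⟨W, hW⟩ 0).unique h₁ (g.linComb_zero b W).symm
  exact (congrFun h₂ l).trans (map_zero _).symm

/-- Over an affine `V` the functions on the preimage are `Γ(X, V) ⊗[R] C`, which is free on the
image of the basis `c`. -/
theorem Hom.isFreeOn_of_isPullback {g : Y ⟶ X} {R C : Type u} [CommRing R] [CommRing C]
    [Algebra R C] {q : Y ⟶ Spec (CommRingCat.of C)} {p : X ⟶ Spec (CommRingCat.of R)}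
    (H : IsPullback g q p (Spec.map (CommRingCat.ofHom (algebraMap R C))))
    (c : Module.Basis ι R C) :
    g.IsFreeOn fun l => q.appTop ((Scheme.ΓSpecIso (CommRingCat.of C)).inv (c l)) := by
  intro V y
  have h₀ := (isIso_pushoutSection_iff H (US := ⊤) (UT := ⊤) (UX := V) (UY := g ⁻¹ᵁ V) le_top
    le_top (by simp)).mp (isIso_pushoutSection_of_isAffineOpen H _ _ _ (isAffineOpen_top _)
      (isAffineOpen_top _) V.2)
  have h₁ : IsPushout ((Scheme.ΓSpecIso (CommRingCat.of R)).inv ≫ p.appLE ⊤ V le_top)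
      (CommRingCat.ofHom (algebraMap R C)) (g.appLE V (g ⁻¹ᵁ V) le_rfl)
      ((Scheme.ΓSpecIso (CommRingCat.of C)).inv ≫ q.appLE ⊤ (g ⁻¹ᵁ V) le_top) := by
    refine h₀.of_iso' (Scheme.ΓSpecIso (CommRingCat.of R)).symm (Iso.refl _)
      (Scheme.ΓSpecIso (CommRingCat.of C)).symm (Iso.refl _) ?_ ?_ ?_ ?_
    · simp
    · simp only [Iso.symm_hom]
      rw [Scheme.ΓSpecIso_inv_naturality]
      exact congrArg _ (Hom.app_eq_appLE (f := Spec.map _)).symm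
    · simp
    · simp
  have h₂ := CommRingCat.existsUnique_sum_of_isPushout (R := CommRingCat.of R)
    (C := CommRingCat.of C) h₁ c y
  have h₃ : ∀ a : ι → Γ(X, V), g.linComb
      (fun l => q.appTop ((Scheme.ΓSpecIso (CommRingCat.of C)).inv (c l))) V a =
      ∑ l, g.appLE V (g ⁻¹ᵁ V) le_rfl (a l) *
        ((Scheme.ΓSpecIso (CommRingCat.of C)).inv ≫ q.appLE ⊤ (g ⁻¹ᵁ V) le_top) (c l) := by
    intro a
    refine Finset.sum_congr rfl fun l _ => ?_
    rw [← g.app_eq_appLE]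
    rfl
  simp only [h₃]
  exact h₂

theorem Hom.linComb_sum (g : Y ⟶ X) (b : ι → Γ(Y, ⊤)) (V : X.Opens) {κ : Type*} (s : Finset κ)
    (c : κ → ι → Γ(X, V)) : g.linComb b V (∑ j ∈ s, c j) = ∑ j ∈ s, g.linComb b V (c j) := by
  classical
  induction s using Finset.induction_on with
  | empty => simpa using g.linComb_zero b V
  | insert j s hj h => rw [Finset.sum_insert hj, Finset.sum_insert hj, Hom.linComb_add, h]

theorem Hom.IsFreeOn.linComb_mem_map_iff {g : Y ⟶ X} {b : ι → Γ(Y, ⊤)} (h : g.IsFreeOn b)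
    (V : X.affineOpens) (J : Ideal Γ(X, V)) (c : ι → Γ(X, V)) :
    g.linComb b V c ∈ J.map (g.app V).hom ↔ ∀ l, c l ∈ J := by
  constructor
  · intro hc
    suffices H : ∃ d : ι → Γ(X, V), g.linComb b V c = g.linComb b V d ∧ ∀ l, d l ∈ J by
      obtain ⟨d, hd, hJ⟩ := H
      rwa [(h V _).unique rfl hd]
    rw [Ideal.map] at hc
    generalize g.linComb b V c = y at hc
    induction hc using Submodule.span_induction with
    | mem x hx =>
      obtain ⟨a, ha, rfl⟩ := hx
      -- The unit need not belong to the basis, so it is expanded in it.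
      obtain ⟨e, he, -⟩ := h V 1
      refine ⟨a • e, ?_, fun l => J.mul_mem_right _ ha⟩
      rw [Hom.linComb_smul, ← he, mul_one]
    | zero => exact ⟨0, (g.linComb_zero b V).symm, fun l => J.zero_mem⟩
    | add x y _ _ hx hy =>
      obtain ⟨d, rfl, hd⟩ := hx
      obtain ⟨e, rfl, he⟩ := hy
      exact ⟨d + e, (g.linComb_add b V d e).symm, fun l => J.add_mem (hd l) (he l)⟩
    | smul s x _ hx =>
      obtain ⟨d, rfl, hd⟩ := hx
      choose e he _ using fun l => h V (Y.presheaf.map (homOfLE le_top).op (b l) * s)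
      refine ⟨∑ l, d l • e l, ?_, fun l => ?_⟩
      · rw [Hom.linComb_sum, Hom.linComb, smul_eq_mul, Finset.mul_sum]
        refine Finset.sum_congr rfl fun l _ => ?_
        rw [Hom.linComb_smul, ← he, mul_comm s, mul_assoc]
      · rw [Finset.sum_apply]
        exact J.sum_mem fun j _ => J.mul_mem_right _ (hd j)
  · intro hc
    exact Ideal.sum_mem _ fun l _ => Ideal.mul_mem_right _ _ (Ideal.mem_map_of_mem _ (hc l))

/-- The ideal generated by the coefficients of the elements of `I`. -/
noncomputable def Hom.coefIdeal (g : Y ⟶ X) (b : ι → Γ(Y, ⊤)) (V : X.Opens)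
    (I : Ideal Γ(Y, g ⁻¹ᵁ V)) : Ideal Γ(X, V) :=
  Ideal.span {a | ∃ c : ι → Γ(X, V), g.linComb b V c ∈ I ∧ ∃ l, c l = a}

theorem Hom.coefIdeal_le_iff (g : Y ⟶ X) (b : ι → Γ(Y, ⊤)) (V : X.Opens)
    (I : Ideal Γ(Y, g ⁻¹ᵁ V)) (J : Ideal Γ(X, V)) :
    g.coefIdeal b V I ≤ J ↔ ∀ c : ι → Γ(X, V), g.linComb b V c ∈ I → ∀ l, c l ∈ J := by
  rw [Hom.coefIdeal, Ideal.span_le]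
  constructor
  · intro h c hc l
    exact h ⟨c, hc, l, rfl⟩
  · rintro h _ ⟨c, hc, l, rfl⟩
    exact h c hc l

/-- An element of a free algebra lies in the extension of `J` exactly when its coefficients lie in
`J`. So the coefficient ideal is the smallest ideal whose extension contains `I`. -/
theorem Hom.IsFreeOn.coefIdeal_le_iff_le_map {g : Y ⟶ X} {b : ι → Γ(Y, ⊤)} (h : g.IsFreeOn b)
    (V : X.affineOpens) (I : Ideal Γ(Y, g ⁻¹ᵁ V)) (J : Ideal Γ(X, V)) :
    g.coefIdeal b V I ≤ J ↔ I ≤ J.map (g.app V).hom := by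
  rw [Hom.coefIdeal_le_iff]
  constructor
  · intro H y hy
    obtain ⟨c, rfl, -⟩ := h V y
    exact (h.linComb_mem_map_iff V J c).mpr (H c hy)
  · intro H c hc
    exact (h.linComb_mem_map_iff V J c).mp (H hc)

/-- The preimage of an affine open under an affine morphism. -/
def Hom.affinePreimage (g : Y ⟶ X) [IsAffineHom g] (V : X.affineOpens) : Y.affineOpens :=
  ⟨g ⁻¹ᵁ V, IsAffineOpen.preimage V.2 g⟩

/-- The ideal of coefficients of an ideal sheaf, over an affine open. -/
noncomputable def Hom.coefIdealAt (g : Y ⟶ X) [IsAffineHom g] (b : ι → Γ(Y, ⊤))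
    (I : Y.IdealSheafData) (V : X.affineOpens) : Ideal Γ(X, V) :=
  g.coefIdeal b V (I.ideal (g.affinePreimage V))

/-- Coefficients restrict to coefficients, which gives one inclusion; the other is the minimality of
the coefficient ideal over `V'`. This is what makes the coefficient ideals an ideal sheaf. -/
theorem Hom.IsFreeOn.map_coefIdealAt {g : Y ⟶ X} [IsAffineHom g] {b : ι → Γ(Y, ⊤)}
    (h : g.IsFreeOn b) (I : Y.IdealSheafData) {V V' : X.affineOpens} (hV : V' ≤ V) :
    (g.coefIdealAt b I V).map (X.presheaf.map (homOfLE hV).op).hom = g.coefIdealAt b I V' := by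
  have hI : (I.ideal (g.affinePreimage V)).map
      (Y.presheaf.map (homOfLE (g.preimage_mono hV)).op).hom = I.ideal (g.affinePreimage V') :=
    I.map_ideal (U := g.affinePreimage V') (V := g.affinePreimage V) (g.preimage_mono hV)
  apply le_antisymm
  · rw [Ideal.map_le_iff_le_comap]
    refine (Hom.coefIdeal_le_iff g b V _ _).mpr ?_
    intro c hc l
    refine Ideal.subset_span ⟨fun l => X.presheaf.map (homOfLE hV).op (c l), ?_, l, rfl⟩
    have h₁ := hI.le (Ideal.mem_map_of_mem
      (Y.presheaf.map (homOfLE (g.preimage_mono hV)).op).hom hc)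
    exact Hom.linComb_map g b hV c ▸ h₁
  · refine (h.coefIdeal_le_iff_le_map V' _ _).mpr ?_
    rw [← hI, Ideal.map_map]
    refine (Ideal.map_mono ((h.coefIdeal_le_iff_le_map V _ _).mp le_rfl)).trans ?_
    rw [Ideal.map_map]
    refine le_of_eq ?_
    congr 1
    exact congrArg CommRingCat.Hom.hom (g.naturality (homOfLE hV).op).symm

/-- The ideal sheaf of the Weil restriction of a closed subscheme along a finite free morphism. -/
noncomputable def Hom.IsFreeOn.coefIdealSheaf {g : Y ⟶ X} [IsAffineHom g] {b : ι → Γ(Y, ⊤)}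
    (h : g.IsFreeOn b) (I : Y.IdealSheafData) : X.IdealSheafData where
  ideal := g.coefIdealAt b I
  map_ideal_basicOpen V f := h.map_coefIdealAt I (V := V) (V' := X.affineBasicOpen f)
    (X.basicOpen_le f)

end LinComb

/-- `f.ker` is the largest ideal sheaf contained in the kernels on affine opens, so it suffices that
sections of `I` pull back to zero. That may be checked near each point of the source, after
shrinking to a common affine open of the target; `f` need not be quasi-compact. -/
theorem le_ker_iff {X Y : Scheme.{u}} (f : X ⟶ Y) (I : Y.IdealSheafData) :
    I ≤ f.ker ↔ ∀ x : X, ∃ W : Y.affineOpens, ∃ W' : X.Opens, x ∈ W' ∧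
      ∃ e : W' ≤ f ⁻¹ᵁ W, I.ideal W ≤ RingHom.ker (f.appLE W W' e).hom := by
  constructor
  · intro h x
    obtain ⟨_, ⟨W, hW, rfl⟩, hxW, -⟩ :=
      Y.isBasis_affineOpens.exists_subset_of_mem_open (Set.mem_univ (f x)) isOpen_univ
    refine ⟨⟨W, hW⟩, f ⁻¹ᵁ W, hxW, le_rfl, ?_⟩
    rw [← Hom.app_eq_appLE]
    exact (h ⟨W, hW⟩).trans (f.ideal_ker_le _)
  · intro h
    rw [Hom.ker, IdealSheafData.le_ofIdeals_iff]
    intro U s hs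
    refine X.IsSheaf.section_ext fun x hx => ?_
    obtain ⟨W, W', hxW', e, hW⟩ := h x
    obtain ⟨_, ⟨U₀, hU₀, rfl⟩, hxU₀, hU₀W⟩ :=
      Y.isBasis_affineOpens.exists_subset_of_mem_open (a := f x) (u := (U.1 ⊓ W.1 : Y.Opens))
        ⟨hx, e hxW'⟩ (U.1 ⊓ W.1).isOpen
    have h₁ : U₀ ≤ U.1 := fun y hy => (hU₀W hy).1
    have h₂ : U₀ ≤ W.1 := fun y hy => (hU₀W hy).2
    refine ⟨W' ⊓ f ⁻¹ᵁ U₀, fun y hy => h₁ hy.2, ⟨hxW', hxU₀⟩, ?_⟩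
    have hs₀ : Y.presheaf.map (homOfLE h₁).op s ∈ I.ideal ⟨U₀, hU₀⟩ := by
      rw [← I.map_ideal (U := ⟨U₀, hU₀⟩) (V := U) h₁]
      exact Ideal.mem_map_of_mem _ hs
    have h₃ : I.ideal ⟨U₀, hU₀⟩ ≤
        RingHom.ker (f.appLE U₀ (W' ⊓ f ⁻¹ᵁ U₀) inf_le_right).hom := by
      rw [← I.map_ideal (U := ⟨U₀, hU₀⟩) (V := W) h₂, Ideal.map_le_iff_le_comap]
      intro t ht
      have h₄ := congr(($(Hom.map_appLE f (V := W' ⊓ f ⁻¹ᵁ U₀) inf_le_right (homOfLE h₂).op)) t)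
      have h₅ := congr(($(Hom.appLE_map f e (homOfLE (inf_le_left : W' ⊓ f ⁻¹ᵁ U₀ ≤ W')).op)) t)
      have h₆ : f.appLE W W' e t = 0 := hW ht
      refine h₄.trans (h₅.symm.trans ?_)
      exact (congrArg _ h₆).trans (map_zero (X.presheaf.map (homOfLE inf_le_left).op).hom)
    have h₇ := congr(($(Hom.map_appLE f (V := W' ⊓ f ⁻¹ᵁ U₀) inf_le_right (homOfLE h₁).op)) s)
    refine Eq.trans ?_ ((h₇.symm.trans (h₃ hs₀)).trans (map_zero _).symm)
    rfl

section LinComb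

variable {X Y X' Y' : Scheme.{u}} {ι : Type*} [Fintype ι]

/-- The universal property of the Weil restriction of a closed subscheme. -/
theorem Hom.IsFreeOn.coefIdealSheaf_le_ker_iff {g : Y ⟶ X} [IsAffineHom g] {b : ι → Γ(Y, ⊤)}
    (h : g.IsFreeOn b) (I : Y.IdealSheafData) {Φ : Y' ⟶ Y} {g' : Y' ⟶ X'} {φ : X' ⟶ X}
    (w : Φ ≫ g = g' ≫ φ) (h' : g'.IsFreeOn fun l => Φ.appTop (b l)) :
    h.coefIdealSheaf I ≤ φ.ker ↔ I ≤ Φ.ker := by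
  -- `Φ` carries the combination with coefficients `c` to the one with coefficients `φ c`. By
  -- freeness over `X'` it vanishes exactly when all `φ (c l)` vanish.
  have key : ∀ (V : X.affineOpens) (V' : X'.Opens) (hV : V' ≤ φ ⁻¹ᵁ V.1)
      (hV' : g' ⁻¹ᵁ V' ≤ Φ ⁻¹ᵁ g ⁻¹ᵁ V.1),
      (h.coefIdealSheaf I).ideal V ≤ RingHom.ker (φ.appLE V V' hV).hom ↔
        I.ideal (g.affinePreimage V) ≤ RingHom.ker (Φ.appLE _ _ hV').hom := by
    intro V V' hV hV'
    constructor
    · intro H y hy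
      replace H := (Hom.coefIdeal_le_iff g b V (I.ideal (g.affinePreimage V)) _).mp H
      obtain ⟨c, rfl, -⟩ := h V y
      refine (Hom.linComb_appLE w b V V' hV hV' c).trans ?_
      rw [show (fun l => φ.appLE V V' hV (c l)) = 0 from funext fun l => H c hy l]
      exact Hom.linComb_zero _ _ _
    · intro H
      refine (Hom.coefIdeal_le_iff g b V (I.ideal (g.affinePreimage V)) _).mpr ?_
      intro c hc l
      exact congrFun (h'.eq_zero V'
        ((Hom.linComb_appLE w b V V' hV hV' c).symm.trans (H hc))) l
  have hle : ∀ (V : X.Opens) (V' : X'.Opens), V' ≤ φ ⁻¹ᵁ V → g' ⁻¹ᵁ V' ≤ Φ ⁻¹ᵁ g ⁻¹ᵁ V := by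
    intro V V' hV
    rw [← Hom.comp_preimage, w, Hom.comp_preimage]
    exact g'.preimage_mono hV
  constructor
  · intro H
    rw [le_ker_iff]
    intro y
    obtain ⟨_, ⟨V, hV, rfl⟩, hyV, -⟩ :=
      X.isBasis_affineOpens.exists_subset_of_mem_open (Set.mem_univ (φ (g' y))) isOpen_univ
    refine ⟨g.affinePreimage ⟨V, hV⟩, g' ⁻¹ᵁ φ ⁻¹ᵁ V, hyV, hle _ _ le_rfl,
      (key ⟨V, hV⟩ _ le_rfl _).mp ?_⟩
    rw [← Hom.app_eq_appLE]
    exact (H ⟨V, hV⟩).trans (φ.ideal_ker_le _)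
  · intro H
    rw [le_ker_iff]
    intro x
    obtain ⟨_, ⟨V, hV, rfl⟩, hxV, -⟩ :=
      X.isBasis_affineOpens.exists_subset_of_mem_open (Set.mem_univ (φ x)) isOpen_univ
    refine ⟨⟨V, hV⟩, φ ⁻¹ᵁ V, hxV, le_rfl, (key ⟨V, hV⟩ _ le_rfl (hle _ _ le_rfl)).mpr ?_⟩
    intro s hs
    have h₁ : Φ.app (g ⁻¹ᵁ V) s = 0 := (H (g.affinePreimage ⟨V, hV⟩)).trans (Φ.ideal_ker_le _) hs
    refine Eq.trans (b := Y'.presheaf.map (homOfLE (hle V _ le_rfl)).op (Φ.app (g ⁻¹ᵁ V) s)) rfl ?_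
    rw [h₁, map_zero]

end LinComb

end Scheme

end AlgebraicGeometry

/-! ### Closed subschemes and their prolongations. -/

section ClosedSub

variable {B : Scheme.{u}} {W : Over B} (I : W.left.IdealSheafData)

instance : IsClosedImmersion (closedSubι W I).left :=
  inferInstanceAs (IsClosedImmersion I.subschemeι)

instance : Mono (closedSubι W I) :=
  Over.mono_of_mono_left _

theorem ker_closedSubι_left : (closedSubι W I).left.ker = I := I.ker_subschemeι

theorem exists_comp_closedSubι_iff {U : Over B} (f : U ⟶ W) :
    (∃ g : U ⟶ closedSub W I, g ≫ closedSubι W I = f) ↔ I ≤ f.left.ker := by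
  constructor
  · rintro ⟨g, rfl⟩
    rw [Over.comp_left]
    exact (ker_closedSubι_left I).ge.trans (Scheme.Hom.le_ker_comp _ _)
  · intro h
    have h' : (closedSubι W I).left.ker ≤ f.left.ker := (ker_closedSubι_left I).le.trans h
    have e := IsClosedImmersion.lift_fac (closedSubι W I).left f.left h'
    refine ⟨Over.homMk (IsClosedImmersion.lift (closedSubι W I).left f.left h') ?_,
      Over.OverMorphism.ext e⟩
    rw [← Over.w (closedSubι W I), ← Category.assoc]
    exact (congrArg (fun t => t ≫ W.hom) e).trans (Over.w f)

end ClosedSub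

namespace IterativeHasseSchmidtRing

variable {A : Type u} [CommRing A] {S : IterativeHasseSchmidtSystem A}
variable {k : Type u} [CommRing k] [Algebra A k] (E : IterativeHasseSchmidtRing S k)

instance (n : ℕ) (U : Over (Spec (CommRingCat.of k))) : IsAffineHom (E.thickenFst n U) :=
  MorphismProperty.of_isPullback (E.thicken_isPullback_std n U).flip inferInstance

/-- The basis of the functions on `U ×ₖ D n (k)` over those on `U`. -/
noncomputable def thickenBasis (n : ℕ) (U : Over (Spec (CommRingCat.of k))) (l : Fin (S.rank n)) :
    Γ(((E.thicken n).obj U).left, ⊤) :=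
  (E.thickenSnd n U).appTop ((Scheme.ΓSpecIso (CommRingCat.of (k ⊗[A] S.D n))).inv
    (Algebra.TensorProduct.basis k (S.basis n) l))

theorem thickenFst_isFreeOn (n : ℕ) (U : Over (Spec (CommRingCat.of k))) :
    (E.thickenFst n U).IsFreeOn (E.thickenBasis n U) :=
  Scheme.Hom.isFreeOn_of_isPullback (E.thicken_isPullback_std n U) _

theorem thicken_map_thickenBasis (n : ℕ) {U V : Over (Spec (CommRingCat.of k))} (f : U ⟶ V)
    (l : Fin (S.rank n)) :
    ((E.thicken n).map f).left.appTop (E.thickenBasis n V l) = E.thickenBasis n U l := by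
  have h := Scheme.Hom.comp_appTop ((E.thicken n).map f).left (E.thickenSnd n V)
  rw [thicken_map_snd] at h
  exact (congr($h _)).symm

variable {E}

namespace Prolongation

variable {n : ℕ} {W : Over (Spec (CommRingCat.of k))} (T : E.Prolongation n W)
  (I : W.left.IdealSheafData)

theorem hom_ext {U : Over (Spec (CommRingCat.of k))} {f g : U ⟶ T.obj}
    (h : (E.thicken n).map f ≫ T.r = (E.thicken n).map g ≫ T.r) : f = g := by
  rw [← T.homEquiv_eq, ← T.homEquiv_eq] at h
  exact T.rep.homEquiv.injective h

/-- The ideal sheaf of `τ n V` in `τ n W`, where `V` is the closed subscheme of `W` given by `I`. -/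
noncomputable def closedIdeal : T.obj.left.IdealSheafData :=
  (E.thickenFst_isFreeOn n T.obj).coefIdealSheaf (I.comap T.r.left)

/-- The basis on `U ×ₖ D n (k)` is the pullback of the basis on the thickening of `T.obj`, so the
universal property of the coefficient ideal applies to every `U`. In terms of functors of points,
the closed subscheme represents the prolongation. -/
theorem closedIdeal_le_ker_iff {U : Over (Spec (CommRingCat.of k))} (f : U ⟶ T.obj) :
    T.closedIdeal I ≤ f.left.ker ↔ I ≤ ((E.thicken n).map f ≫ T.r).left.ker := by
  have h := E.thickenFst_isFreeOn n U
  rw [← funext (E.thicken_map_thickenBasis n f)] at h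
  rw [closedIdeal, Scheme.Hom.IsFreeOn.coefIdealSheaf_le_ker_iff _ _ (E.thicken_map_fst n f) h,
    Over.comp_left, Scheme.Hom.ker_comp, Scheme.IdealSheafData.le_map_iff_comap_le]

theorem exists_comp_closedIdeal_iff {U : Over (Spec (CommRingCat.of k))} (f : U ⟶ T.obj) :
    (∃ g : U ⟶ closedSub T.obj (T.closedIdeal I), g ≫ closedSubι _ _ = f) ↔
      ∃ g : (E.thicken n).obj U ⟶ closedSub W I, g ≫ closedSubι _ _ = (E.thicken n).map f ≫ T.r := by
  rw [exists_comp_closedSubι_iff, exists_comp_closedSubι_iff, closedIdeal_le_ker_iff]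

theorem exists_closed_r :
    ∃ r : (E.thicken n).obj (closedSub T.obj (T.closedIdeal I)) ⟶ closedSub W I,
      r ≫ closedSubι _ _ = (E.thicken n).map (closedSubι _ _) ≫ T.r :=
  (T.exists_comp_closedIdeal_iff I _).mp ⟨𝟙 _, Category.id_comp _⟩

/-- The prolongation of a closed subscheme of `W` exists if the prolongation of `W` does. -/
noncomputable def closed : E.Prolongation n (closedSub W I) where
  obj := closedSub T.obj (T.closedIdeal I)
  rep :=
    { homEquiv := Equiv.ofBijective (fun f => (E.thicken n).map f ≫ (T.exists_closed_r I).choose) (by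
        have hr := (T.exists_closed_r I).choose_spec
        constructor
        · intro f g h
          have h' := congrArg (fun t => t ≫ closedSubι W I) h
          simp only [Category.assoc, hr] at h'
          rw [← cancel_mono (closedSubι T.obj (T.closedIdeal I))]
          apply T.hom_ext
          rw [Functor.map_comp, Functor.map_comp, Category.assoc, Category.assoc]
          exact h'
        · intro h
          obtain ⟨g, hg⟩ := (T.exists_comp_closedIdeal_iff I (T.lift (h ≫ closedSubι W I))).mpr
            ⟨h, (T.thicken_map_lift _).symm⟩
          refine ⟨g, ?_⟩
          rw [← cancel_mono (closedSubι W I)]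
          change ((E.thicken n).map g ≫ _) ≫ _ = _
          rw [Category.assoc, hr, ← Category.assoc, ← Functor.map_comp, hg, T.thicken_map_lift])
      homEquiv_comp := fun f g => by
        change (E.thicken n).map (f ≫ g) ≫ _ = (E.thicken n).map f ≫ (E.thicken n).map g ≫ _
        rw [Functor.map_comp, Category.assoc] }

theorem closed_r_comp : (T.closed I).r ≫ closedSubι W I =
    (E.thicken n).map (closedSubι T.obj (T.closedIdeal I)) ≫ T.r := by
  have h : (T.closed I).r = (T.exists_closed_r I).choose := by
    change (E.thicken n).map (𝟙 _) ≫ _ = _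
    rw [CategoryTheory.Functor.map_id]
    exact Category.id_comp _
  rw [h]
  exact (T.exists_closed_r I).choose_spec

theorem closed_map : (T.closed I).map T (closedSubι W I) =
    closedSubι T.obj (T.closedIdeal I) := by
  apply T.hom_ext
  rw [Prolongation.map, T.thicken_map_lift]
  exact T.closed_r_comp I

end Prolongation

end IterativeHasseSchmidtRing

/-! ### Scheme-theoretic dominance of `thickenΔ`. -/

namespace AlgebraicGeometry

theorem isSchemeTheoreticallyDominant_specMap {R R' : CommRingCat.{u}} (φ : R ⟶ R')
    (h : Function.Injective φ) : IsSchemeTheoreticallyDominant (Spec.map φ) := by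
  have h₁ : Function.Injective ((Spec.map φ).appTop ≫ (Scheme.ΓSpecIso R').hom) := by
    rw [Scheme.ΓSpecIso_naturality]
    exact h.comp (ConcreteCategory.bijective_of_isIso (Scheme.ΓSpecIso R).hom).1
  have h₂ : Function.Injective (Spec.map φ).appTop.hom :=
    Function.Injective.of_comp (f := (Scheme.ΓSpecIso R').hom) h₁
  refine ⟨?_⟩
  rw [Scheme.ker_of_isAffine, (RingHom.injective_iff_ker_eq_bot _).mp h₂]
  ext U : 2
  exact Ideal.map_bot

end AlgebraicGeometry

namespace IterativeHasseSchmidtRing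

open Algebra.TensorProduct (includeLeft includeRight)

section

variable {A : Type u} [CommRing A] {S : IterativeHasseSchmidtSystem A}
variable {k : Type u} [CommRing k] [Algebra A k] (E : IterativeHasseSchmidtRing S k)

/-- The `k`-scheme `Spec k`. -/
noncomputable abbrev pt (k : Type u) [CommRing k] : Over (Spec (CommRingCat.of k)) :=
  Over.mk (𝟙 (Spec (CommRingCat.of k)))

variable (S k) in
-- The `A`-linear retraction of `Δ` survives tensoring with `k`, whereas bare injectivity of `Δ`
-- need not.
theorem ΔHom_injective (m n : ℕ) : Function.Injective (ΔHom S k m n) := by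
  obtain ⟨ρ, hρ⟩ := S.Δ_closedEmbedding m n
  let c := Algebra.TensorProduct.comm A (S.D m) (S.D n)
  have h : ((ρ ∘ₗ c.symm.toLinearMap).lTensor k) ∘ₗ
      (Algebra.TensorProduct.map (AlgHom.id A k) (c.toAlgHom.comp (S.Δ m n))).toLinearMap =
      LinearMap.id := by
    ext x y
    have h₁ := LinearMap.congr_fun hρ y
    simpa using congrArg (fun z => x ⊗ₜ[A] z) h₁
  have h' : Function.Injective
      (Algebra.TensorProduct.map (AlgHom.id A k) (c.toAlgHom.comp (S.Δ m n))) :=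
    Function.LeftInverse.injective fun z => LinearMap.congr_fun h z
  exact (Algebra.TensorProduct.assoc A A A k (S.D n) (S.D m)).symm.injective.comp h'

instance (n : ℕ) (U : Over (Spec (CommRingCat.of k))) : IsFinite (E.thickenFst n U) := by
  have : IsFinite (stdSpec S k n) := by
    rw [stdSpec, IsFinite.SpecMap_iff]
    have : Module.Finite A (S.D n) := .of_basis (S.basis n)
    exact RingHom.finite_algebraMap.mpr (inferInstanceAs (Module.Finite k (k ⊗[A] S.D n)))
  exact MorphismProperty.of_isPullback (E.thicken_isPullback_std n U).flip this

/-- Both thickenings of `U` are the base changes along `U → V` of those of `V`, by pasting, and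
`thickenΔ` respects the projections. With `V = Spec k` this transports properties of `Δ` itself to
every `U`. -/
theorem thickenΔ_isPullback (m n : ℕ) {U V : Over (Spec (CommRingCat.of k))} (f : U ⟶ V) :
    IsPullback (E.thickenΔ m n U).left ((E.thicken m).map ((E.thicken n).map f)).left
      ((E.thicken (m + n)).map f).left (E.thickenΔ m n V).left := by
  have h₁ := (E.thicken_map_isPullback m ((E.thicken n).map f)).paste_horiz
    (E.thicken_map_isPullback n f)
  rw [← thickenΔ_fst, ← thickenΔ_fst] at h₁
  exact h₁.of_right (congrArg CommaMorphism.left (E.thickenΔ_naturality m n f)).symm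
    (E.thicken_map_isPullback (m + n) f)

instance (n : ℕ) : IsIso (E.thickenSnd n (pt k)) :=
  have : IsIso (pt k).hom := inferInstanceAs (IsIso (𝟙 _))
  (E.thicken_isPullback_std n (pt k)).isIso_snd_of_isIso

instance (n : ℕ) (U : Over (Spec (CommRingCat.of k))) [IsAffine U.left] :
    IsAffine ((E.thicken n).obj U).left :=
  isAffine_of_isAffineHom (E.thickenFst n U)

instance : IsAffine (pt k).left := inferInstanceAs (IsAffine (Spec _))

theorem isPullback_spec_tensor (B C : Type u) [CommRing B] [CommRing C] [Algebra A B]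
    [Algebra A C] :
    IsPullback (specAlgHom (includeLeft : B →ₐ[A] B ⊗[A] C))
      (specAlgHom (includeRight : C →ₐ[A] B ⊗[A] C))
      (Spec.map (CommRingCat.ofHom (algebraMap A B)))
      (Spec.map (CommRingCat.ofHom (algebraMap A C))) :=
  isPullback_SpecMap_of_isPushout _ _ _ _ (CommRingCat.isPushout_tensorProduct A B C)

theorem thickenD_isPullback (n : ℕ) (U : Over (Spec (CommRingCat.of k))) :
    IsPullback (E.thickenFst n U) (E.thickenD n U)
      (U.hom ≫ Spec.map (CommRingCat.ofHom (algebraMap A k)))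
      (Spec.map (CommRingCat.ofHom (algebraMap A (S.D n)))) :=
  (E.thicken_isPullback_std n U).paste_vert (isPullback_spec_tensor k (S.D n))

instance (m n : ℕ) : IsIso (E.doubleThickenSnd m n (pt k)) := by
  have h := E.thickenD_isPullback m ((E.thicken n).obj (pt k))
  have e : ((E.thicken n).obj (pt k)).hom ≫ Spec.map (CommRingCat.ofHom (algebraMap A k)) =
      E.thickenSnd n (pt k) ≫
        Spec.map (CommRingCat.ofHom (algebraMap A (k ⊗[A] S.D n))) := by
    rw [thicken_obj_hom, Category.assoc]
    exact congrArg _ (specAlgHom_structure (E.E n))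
  rw [e, ← doubleThickenSnd_right] at h
  exact (h.flip.of_right (E.doubleThickenSnd_left m n (pt k))
    (isPullback_spec_tensor (k ⊗[A] S.D n) (S.D m)).flip).isIso_fst_of_isIso

/-- The thickenings of `Spec k` are the spectra of `D (m + n) (k)` and `D m (D n (k))`, and
`thickenΔ` is up to these isomorphisms the spectrum of the injection `ΔHom`. -/
instance isSchemeTheoreticallyDominant_thickenΔ_pt (m n : ℕ) :
    IsSchemeTheoreticallyDominant (E.thickenΔ m n (pt k)).left := by
  have e : (E.thickenΔ m n (pt k)).left ≫ E.thickenSnd (m + n) (pt k) =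
      E.doubleThickenSnd m n (pt k) ≫ specAlgHom (ΔHom S k m n) :=
    pullback.lift_snd _ _ _
  have h : IsSchemeTheoreticallyDominant (specAlgHom (ΔHom S k m n)) :=
    isSchemeTheoreticallyDominant_specMap (CommRingCat.ofHom (ΔHom S k m n).toRingHom)
      (ΔHom_injective S k m n)
  rw [← cancel_mono (inv (E.thickenSnd (m + n) (pt k))), Category.assoc, IsIso.hom_inv_id,
    Category.comp_id] at e
  rw [e]
  infer_instance

end

section

variable {A : Type u} [CommRing A] {S : IterativeHasseSchmidtSystem A}
variable {k : Type u} [Field k] [Algebra A k] (E : IterativeHasseSchmidtRing S k)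

/-- Every `U` is flat over the field `k`, and scheme-theoretic dominance is preserved by flat base
change from the case of `Spec k`. -/
instance isSchemeTheoreticallyDominant_thickenΔ (m n : ℕ) (U : Over (Spec (CommRingCat.of k))) :
    IsSchemeTheoreticallyDominant (E.thickenΔ m n U).left := by
  let f : U ⟶ pt k := Over.mkIdTerminal.from U
  have hk : ∀ g : U.left ⟶ Spec (CommRingCat.of k), Flat g := fun g => inferInstance
  have hf : Flat f.left := hk f.left
  have : Flat ((E.thicken (m + n)).map f).left :=
    MorphismProperty.of_isPullback (E.thicken_map_isPullback (m + n) f) hf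
  exact .of_isPullback (E.thickenΔ_isPullback m n f).flip

end

end IterativeHasseSchmidtRing

/-! ### The morphism `τ (m + n) X → τ n (τ m X)`. -/

namespace IterativeHasseSchmidtRing

section

variable {A : Type u} [CommRing A] {S : IterativeHasseSchmidtSystem A}
variable {k : Type u} [CommRing k] [Algebra A k] {E : IterativeHasseSchmidtRing S k}

namespace Prolongation

variable {X U : Over (Spec (CommRingCat.of k))} {m n : ℕ}

theorem map_thicken_delta_r (T : E.Prolongation (m + n) X) (T' : E.Prolongation m X)
    (T'' : E.Prolongation n T'.obj) (f : U ⟶ T.obj) :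
    (E.thicken n).map (f ≫ T.delta T' T'') ≫ T''.r =
      (E.thicken n).map f ≫ T.deltaTranspose T' := by
  rw [Functor.map_comp, Category.assoc, delta, thicken_map_lift]

theorem map_thicken_deltaTranspose_r (T : E.Prolongation (m + n) X) (T' : E.Prolongation m X)
    (f : U ⟶ T.obj) :
    (E.thicken m).map ((E.thicken n).map f ≫ T.deltaTranspose T') ≫ T'.r =
      E.thickenΔ m n U ≫ (E.thicken (m + n)).map f ≫ T.r := by
  rw [Functor.map_comp, Category.assoc, deltaTranspose, thicken_map_lift, ← Category.assoc,
    thickenΔ_naturality, Category.assoc]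

theorem map_thicken_proj_r (h : n ≤ m) (T : E.Prolongation m X) (T' : E.Prolongation n X)
    (f : U ⟶ T.obj) :
    (E.thicken n).map (f ≫ T.proj h T') ≫ T'.r =
      E.thickenπ h U ≫ (E.thicken m).map f ≫ T.r := by
  rw [Functor.map_comp, Category.assoc, proj, thicken_map_lift, ← Category.assoc,
    thickenπ_naturality, Category.assoc]

theorem map_thicken_nabla_r (T : E.Prolongation n X) (p : Point X) :
    (E.thicken n).map (T.nabla p) ≫ T.r = Over.mkIdTerminal.from _ ≫ p := by
  rw [nabla, thicken_map_lift]

theorem nabla_delta (T : E.Prolongation (m + n) X) (T' : E.Prolongation m X)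
    (T'' : E.Prolongation n T'.obj) (p : Point X) :
    T.nabla p ≫ T.delta T' T'' = T''.nabla (T'.nabla p) := by
  apply T''.hom_ext
  apply T'.hom_ext
  rw [map_thicken_delta_r, map_thicken_deltaTranspose_r, map_thicken_nabla_r, map_thicken_nabla_r,
    Functor.map_comp, Category.assoc, map_thicken_nabla_r, ← Category.assoc, ← Category.assoc]
  congr 1
  exact Over.mkIdTerminal.hom_ext _ _

end Prolongation

end

section

variable {A : Type u} [CommRing A] {S : IterativeHasseSchmidtSystem A}
variable {k : Type u} [Field k] [Algebra A k] {E : IterativeHasseSchmidtRing S k}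

namespace Prolongation

variable {X : Over (Spec (CommRingCat.of k))} {m n : ℕ}

/-- Transposing twice turns equality after `δ` into equality after precomposition with `thickenΔ`,
which can be cancelled against the separated `X`. -/
theorem mono_delta [IsSeparated X.hom] (T : E.Prolongation (m + n) X) (T' : E.Prolongation m X)
    (T'' : E.Prolongation n T'.obj) : Mono (T.delta T' T'') where
  right_cancellation {U} f g h := by
    apply T.hom_ext
    have h₁ := congrArg (fun t => (E.thicken m).map ((E.thicken n).map t ≫ T''.r) ≫ T'.r) h
    simp only [map_thicken_delta_r, map_thicken_deltaTranspose_r] at h₁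
    apply Over.OverMorphism.ext
    exact eq_of_isSchemeTheoreticallyDominant (E.thickenΔ m n U).left X.hom
      ((Over.w _).trans (Over.w _).symm) (congrArg CommaMorphism.left h₁)

/-- The valuative criterion for `τ (m + n) X → τ n (τ m X)`. -/
theorem exists_lift_delta [IsSeparated X.hom] (T : E.Prolongation (m + n) X)
    (T' : E.Prolongation m X) (T'' : E.Prolongation n T'.obj)
    {O K : Over (Spec (CommRingCat.of k))} [IsAffine O.left] [IsAffine K.left] (c : K ⟶ O)
    [IsSchemeTheoreticallyDominant c.left] (x : K ⟶ T.obj) (y : O ⟶ T''.obj)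
    (h : x ≫ T.delta T' T'' = c ≫ y) :
    ∃ z : O ⟶ T.obj, c ≫ z = x ∧ z ≫ T.delta T' T'' = y := by
  -- `φ` is `y` transposed twice, a morphism on the double thickening of `O`. A lift of `y` to `τ (m
  -- + n) X` is a factorization of `φ` through `thickenΔ`, and `ψ'` provides one over `K`.
  let φ := (E.thicken m).map ((E.thicken n).map y ≫ T''.r) ≫ T'.r
  let ψ' := (E.thicken (m + n)).map x ≫ T.r
  have h₁ := congrArg (fun t => (E.thicken m).map ((E.thicken n).map t ≫ T''.r) ≫ T'.r) h
  simp only [map_thicken_delta_r, map_thicken_deltaTranspose_r] at h₁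
  have h₂ : E.thickenΔ m n K ≫ ψ' = (E.thicken m).map ((E.thicken n).map c) ≫ φ := by
    refine h₁.trans ?_
    simp only [φ, Functor.map_comp, Category.assoc]
  let o : O ⟶ pt k := Over.mkIdTerminal.from O
  have huc : UniversallyClosed ((E.thickenΔ m n (pt k)).left ≫ E.thickenFst (m + n) (pt k)) := by
    rw [thickenΔ_fst]
    infer_instance
  obtain ⟨ψ, hψ, hψφ, hψc⟩ := exists_descent_of_isSchemeTheoreticallyDominant
    (s := o.left) (q₀ := E.thickenFst (m + n) (pt k))
    (E.thicken_map_isPullback (m + n) o) (E.thickenΔ_isPullback m n o)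
    (E.thicken_map_isPullback (m + n) c) (E.thickenΔ_isPullback m n c)
    X.hom ((E.thicken (m + n)).obj O).hom φ.left
    ((Over.w φ).trans (Over.w (E.thickenΔ m n O)).symm) ψ'.left
    ((Over.w ψ').trans (Over.w ((E.thicken (m + n)).map c)).symm) (congrArg CommaMorphism.left h₂)
  let ψ₀ : (E.thicken (m + n)).obj O ⟶ X := Over.homMk ψ hψ
  have e₁ : E.thickenΔ m n O ≫ ψ₀ = φ := Over.OverMorphism.ext hψφ
  have e₂ : (E.thicken (m + n)).map c ≫ ψ₀ = ψ' := Over.OverMorphism.ext hψc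
  refine ⟨T.lift ψ₀, ?_, ?_⟩
  · apply T.hom_ext
    rw [Functor.map_comp, Category.assoc, thicken_map_lift, e₂]
  · apply T''.hom_ext
    apply T'.hom_ext
    rw [map_thicken_delta_r, map_thicken_deltaTranspose_r, thicken_map_lift, e₁]

/-- A proper monomorphism is a closed immersion. Finite type and quasi-compactness come from `Z`,
separatedness from being a monomorphism, and universal closedness from the existence part of the
valuative criterion. -/
theorem isClosedImmersion_comp_delta [IsSeparated X.hom] (T : E.Prolongation (m + n) X)
    (T' : E.Prolongation m X) (T'' : E.Prolongation n T'.obj) {Z : Over (Spec (CommRingCat.of k))}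
    (i : Z ⟶ T.obj) [IsClosedImmersion i.left] [LocallyOfFiniteType Z.hom] [QuasiCompact Z.hom] :
    IsClosedImmersion (i ≫ T.delta T' T'').left := by
  have := T.mono_delta T' T''
  set f := i ≫ T.delta T' T'' with hf
  have hm : Mono f.left := by
    have : Mono (T.delta T' T'').left := inferInstance
    rw [hf, Over.comp_left]
    exact mono_comp _ _
  have hft : LocallyOfFiniteType f.left := by
    have : LocallyOfFiniteType (f.left ≫ T''.obj.hom) := by
      rw [Over.w]
      infer_instance
    exact locallyOfFiniteType_of_comp f.left T''.obj.hom
  have hln : IsLocallyNoetherian Z.left := by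
    have : IsLocallyNoetherian (Spec (CommRingCat.of k)) := inferInstance
    exact LocallyOfFiniteType.isLocallyNoetherian (Y := Spec (CommRingCat.of k)) Z.hom
  have hcs : CompactSpace Z.left :=
    QuasiCompact.compactSpace_of_compactSpace (Y := Spec (CommRingCat.of k)) Z.hom
  have hn : IsNoetherian Z.left := {}
  have hqc : QuasiCompact f.left := inferInstance
  have huc : UniversallyClosed f.left := by
    refine UniversallyClosed.of_valuativeCriterion _ fun V => ?_
    let O : Over (Spec (CommRingCat.of k)) := Over.mk (V.i₂ ≫ T''.obj.hom)
    let K : Over (Spec (CommRingCat.of k)) :=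
      Over.mk (Spec.map (CommRingCat.ofHom (algebraMap V.R V.K)) ≫ O.hom)
    let c : K ⟶ O := Over.homMk (Spec.map (CommRingCat.ofHom (algebraMap V.R V.K))) rfl
    let y : O ⟶ T''.obj := Over.homMk V.i₂ rfl
    let x : K ⟶ Z := Over.homMk V.i₁ (by
      rw [← Over.w f, ← Category.assoc, V.commSq.w]
      exact Category.assoc _ _ _)
    have hxy : x ≫ f = c ≫ y := Over.OverMorphism.ext V.commSq.w
    have : IsAffine O.left := inferInstanceAs (IsAffine (Spec _))
    have : IsAffine K.left := inferInstanceAs (IsAffine (Spec _))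
    have : IsSchemeTheoreticallyDominant c.left :=
      isSchemeTheoreticallyDominant_specMap _ (IsFractionRing.injective V.R V.K)
    obtain ⟨z, hz₁, hz₂⟩ := T.exists_lift_delta T' T'' c (x ≫ i) y
      ((Category.assoc _ _ _).trans hxy)
    -- The lift in `τ (m + n) X` stays in the closed `Z` because its generic point lies there.
    obtain ⟨w, hw₁, hw₂⟩ := exists_lift_of_isSchemeTheoreticallyDominant c.left i.left x.left
      z.left (congrArg CommaMorphism.left hz₁.symm)
    refine ⟨⟨w, hw₂, ?_⟩⟩
    have e₁ : w ≫ f.left = (w ≫ i.left) ≫ (T.delta T' T'').left := (Category.assoc _ _ _).symm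
    rw [e₁, hw₁]
    exact congrArg CommaMorphism.left hz₂
  have : IsProper f.left := {}
  exact (IsClosedImmersion.iff_isProper_and_mono f.left).mpr ⟨this, hm⟩

end Prolongation

end

end IterativeHasseSchmidtRing

/-! ### Augmentations and the counit laws. -/

section

variable {A : Type u} [CommRing A] (S : IterativeHasseSchmidtSystem A)

namespace IterativeHasseSchmidtSystem

open Algebra.TensorProduct (includeLeft includeRight)

/-- The augmentation `D n → D 0 = A`. -/
noncomputable def aug (n : ℕ) : S.D n →ₐ[A] A :=
  (AlgEquiv.ofBijective (Algebra.ofId A (S.D 0)) S.zero_bijective).symm.toAlgHom.comp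
    (S.π (Nat.zero_le n))

theorem aug_comp_π {m n : ℕ} (h : n ≤ m) : (S.aug n).comp (S.π h) = S.aug m := by
  rw [aug, aug, AlgHom.comp_assoc, S.π_comp]

/-- The homomorphism `D m ⊗ D n → D n` given by the augmentation of `D m`. -/
noncomputable def augLeft (m n : ℕ) : S.D m ⊗[A] S.D n →ₐ[A] S.D n :=
  Algebra.TensorProduct.lift ((Algebra.ofId A (S.D n)).comp (S.aug m)) (AlgHom.id A _)
    fun _ _ => Commute.all _ _

/-- The homomorphism `D m ⊗ D n → D m` given by the augmentation of `D n`. -/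
noncomputable def augRight (m n : ℕ) : S.D m ⊗[A] S.D n →ₐ[A] S.D m :=
  Algebra.TensorProduct.lift (AlgHom.id A _) ((Algebra.ofId A (S.D m)).comp (S.aug n))
    fun _ _ => Commute.all _ _

theorem augLeft_comp_includeLeft (m n : ℕ) :
    (S.augLeft m n).comp includeLeft = (Algebra.ofId A (S.D n)).comp (S.aug m) :=
  AlgHom.ext fun x => by simp [augLeft]

theorem augLeft_comp_includeRight (m n : ℕ) :
    (S.augLeft m n).comp includeRight = AlgHom.id A (S.D n) :=
  AlgHom.ext fun x => by simp [augLeft]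

theorem augRight_comp_includeLeft (m n : ℕ) :
    (S.augRight m n).comp includeLeft = AlgHom.id A (S.D m) :=
  AlgHom.ext fun x => by simp [augRight]

theorem augRight_comp_includeRight (m n : ℕ) :
    (S.augRight m n).comp includeRight = (Algebra.ofId A (S.D m)).comp (S.aug n) :=
  AlgHom.ext fun x => by simp [augRight]

/-- The augmentation of `D m` factors through `π : D m → D 0`, so compatibility with `π` reduces the
claim to `Δ (0, n) = id`. -/
theorem augLeft_comp_Δ (m n : ℕ) :
    (S.augLeft m n).comp (S.Δ m n) = S.π (Nat.le_add_left n m) := by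
  have h : (S.augLeft 0 n).comp (Algebra.TensorProduct.map (S.π (Nat.zero_le m))
      (S.π (le_refl n))) = S.augLeft m n := by
    apply Algebra.TensorProduct.ext'
    intro a b
    simp [augLeft, S.π_self, ← S.aug_comp_π (Nat.zero_le m)]
  rw [← h, AlgHom.comp_assoc, S.Δ_π, S.Δ_left_zero, ← AlgHom.comp_assoc, ← AlgHom.comp_assoc,
    augLeft_comp_includeRight,
    AlgHom.id_comp, S.π_comp]

theorem augRight_comp_Δ (m n : ℕ) :
    (S.augRight m n).comp (S.Δ m n) = S.π (Nat.le_add_right m n) := by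
  have h : (S.augRight m 0).comp (Algebra.TensorProduct.map (S.π (le_refl m))
      (S.π (Nat.zero_le n))) = S.augRight m n := by
    apply Algebra.TensorProduct.ext'
    intro a b
    simp [augRight, S.π_self, ← S.aug_comp_π (Nat.zero_le n)]
  rw [← h, AlgHom.comp_assoc, S.Δ_π, S.Δ_right_zero, ← AlgHom.comp_assoc]
  exact congrArg (fun f => f.comp (S.π (Nat.le_add_right m n))) (S.augRight_comp_includeLeft m 0)

end IterativeHasseSchmidtSystem

end

namespace IterativeHasseSchmidtRing

open Algebra.TensorProduct (includeLeft includeRight)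

section

variable {A : Type u} [CommRing A] {S : IterativeHasseSchmidtSystem A}
variable {k : Type u} [CommRing k] [Algebra A k] (E : IterativeHasseSchmidtRing S k)

variable (S k) in
/-- The augmentation `D n (k) → k`. -/
noncomputable def aug (n : ℕ) : k ⊗[A] S.D n →ₐ[A] k :=
  Algebra.TensorProduct.lift (AlgHom.id A k) ((Algebra.ofId A k).comp (S.aug n))
    fun _ _ => Commute.all _ _

theorem aug_comp_E (n : ℕ) : (aug S k n).comp (E.E n) = AlgHom.id A k := by
  have h : (aug S k 0).comp (Algebra.TensorProduct.map (AlgHom.id A k) (S.π (Nat.zero_le n))) =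
      aug S k n := by
    apply Algebra.TensorProduct.ext'
    intro a b
    simp [aug, ← S.aug_comp_π (Nat.zero_le n)]
  rw [← h, AlgHom.comp_assoc, E.E_π, E.E_zero]
  exact Algebra.TensorProduct.lift_comp_includeLeft _ _ _

/-- The section `U → U ×ₖ D n (k)` given by the augmentation of `D n`. -/
noncomputable def unit (n : ℕ) (U : Over (Spec (CommRingCat.of k))) :
    U ⟶ (E.thicken n).obj U :=
  Over.homMk ((E.thicken_isPullback_std n U).lift (𝟙 _) (U.hom ≫ specAlgHom (aug S k n)) (by
      have h : (aug S k n).comp (includeLeft : k →ₐ[A] k ⊗[A] S.D n) = AlgHom.id A k :=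
        Algebra.TensorProduct.lift_comp_includeLeft _ _ _
      have h' : specAlgHom (aug S k n) ≫ stdSpec S k n = 𝟙 _ :=
        (specAlgHom_comp _ _).trans ((congrArg specAlgHom h).trans specAlgHom_id)
      rw [Category.assoc, h', Category.id_comp, Category.comp_id])) (by
    have h' : specAlgHom (aug S k n) ≫ E.expSpec n = 𝟙 _ :=
      (specAlgHom_comp _ _).trans ((congrArg specAlgHom (E.aug_comp_E n)).trans specAlgHom_id)
    rw [thicken_obj_hom, ← Category.assoc, IsPullback.lift_snd, Category.assoc, h',
      Category.comp_id])

theorem unit_fst (n : ℕ) (U : Over (Spec (CommRingCat.of k))) :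
    (E.unit n U).left ≫ E.thickenFst n U = 𝟙 _ :=
  (E.thicken_isPullback_std n U).lift_fst _ _ _

theorem unit_D (n : ℕ) (U : Over (Spec (CommRingCat.of k))) :
    (E.unit n U).left ≫ E.thickenD n U =
      (U.hom ≫ Spec.map (CommRingCat.ofHom (algebraMap A k))) ≫ specAlgHom (S.aug n) := by
  have h : (E.unit n U).left ≫ E.thickenSnd n U = U.hom ≫ specAlgHom (aug S k n) :=
    (E.thicken_isPullback_std n U).lift_snd _ _ _
  have h' : (aug S k n).comp (includeRight : S.D n →ₐ[A] k ⊗[A] S.D n) =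
      (Algebra.ofId A k).comp (S.aug n) :=
    AlgHom.ext fun x => by simp [aug]
  rw [thickenD, ← Category.assoc, h, specAlgHom_comp_assoc, h', ← specAlgHom_comp,
    ← Category.assoc]
  rfl

theorem unit_naturality (n : ℕ) {U V : Over (Spec (CommRingCat.of k))} (f : U ⟶ V) :
    E.unit n U ≫ (E.thicken n).map f = f ≫ E.unit n V := by
  apply Over.OverMorphism.ext
  apply E.thicken_hom_ext
  · rw [Over.comp_left, Over.comp_left, Category.assoc, Category.assoc, thicken_map_fst, unit_fst,
      ← Category.assoc, unit_fst, Category.id_comp, Category.comp_id]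
  · rw [Over.comp_left, Over.comp_left, Category.assoc, Category.assoc, thicken_map_D, unit_D,
      unit_D, ← Category.assoc, ← Category.assoc, Over.w]

/-- The counit law `Δ (0, n) = id`. -/
theorem unit_thickenΔ (m n : ℕ) (U : Over (Spec (CommRingCat.of k))) :
    E.unit m ((E.thicken n).obj U) ≫ E.thickenΔ m n U = E.thickenπ (Nat.le_add_left n m) U := by
  have hD : (E.unit m ((E.thicken n).obj U)).left ≫ E.doubleThickenD m n U =
      E.thickenD n U ≫ specAlgHom (S.augLeft m n) := by
    apply spec_tensor_hom_ext
    · rw [Category.assoc, doubleThickenD_left, unit_D, ← thickenD_structure, specAlgHom_comp_assoc,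
        S.augLeft_comp_includeLeft,
        ← specAlgHom_comp, ← Category.assoc]
      rfl
    · rw [Category.assoc, doubleThickenD_right, ← Category.assoc, unit_fst, Category.id_comp,
        specAlgHom_comp_assoc, S.augLeft_comp_includeRight, specAlgHom_id, Category.comp_id]
  apply Over.OverMorphism.ext
  apply E.thicken_hom_ext
  · rw [thickenπ_fst, Over.comp_left, Category.assoc, thickenΔ_fst, ← Category.assoc, unit_fst,
      Category.id_comp]
  · rw [thickenπ_D, Over.comp_left, Category.assoc, thickenΔ_D, ← Category.assoc, hD,
      specAlgHom_comp_assoc, S.augLeft_comp_Δ]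

/-- The counit law `Δ (m, 0) = id`. -/
theorem map_unit_thickenΔ (m n : ℕ) (U : Over (Spec (CommRingCat.of k))) :
    (E.thicken m).map (E.unit n U) ≫ E.thickenΔ m n U = E.thickenπ (Nat.le_add_right m n) U := by
  have hD : ((E.thicken m).map (E.unit n U)).left ≫ E.doubleThickenD m n U =
      E.thickenD m U ≫ specAlgHom (S.augRight m n) := by
    apply spec_tensor_hom_ext
    · rw [Category.assoc, doubleThickenD_left, thicken_map_D,
        specAlgHom_comp_assoc, S.augRight_comp_includeLeft, specAlgHom_id, Category.comp_id]
    · rw [Category.assoc, doubleThickenD_right, ← Category.assoc, thicken_map_fst, Category.assoc,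
        unit_D, ← Category.assoc, thickenFst_structure, ← thickenD_structure,
        specAlgHom_comp_assoc, S.augRight_comp_includeRight, ← specAlgHom_comp, ← Category.assoc]
      rfl
  apply Over.OverMorphism.ext
  apply E.thicken_hom_ext
  · rw [thickenπ_fst, Over.comp_left, Category.assoc, thickenΔ_fst, ← Category.assoc,
      thicken_map_fst, Category.assoc, unit_fst, Category.comp_id]
  · rw [thickenπ_D, Over.comp_left, Category.assoc, thickenΔ_D, ← Category.assoc, hD,
      specAlgHom_comp_assoc, S.augRight_comp_Δ]

end

section

variable {A : Type u} [CommRing A] {S : IterativeHasseSchmidtSystem A}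
variable {k : Type u} [CommRing k] [Algebra A k] {E : IterativeHasseSchmidtRing S k}

/-! ### Points of `τ (m + n) X` that `δ` sends to some `∇ n q`. -/

namespace Prolongation

variable {X : Over (Spec (CommRingCat.of k))} {m n : ℕ}

/-- The point of `X` below a point of `τ m X`. -/
noncomputable def base (T : E.Prolongation m X) (q : Point T.obj) : Point X :=
  E.unit m _ ≫ (E.thicken m).map q ≫ T.r

/-- The hypothesis transposed twice. As `∇ n q` is `q` composed with the structure morphism of `D n
(k)` given by `E n`, the right side is the morphism of `q` on `D m (k)`, precomposed with `E n`. -/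
theorem thickenΔ_eq_of_delta_eq_nabla (T : E.Prolongation (m + n) X) (T' : E.Prolongation m X)
    (T'' : E.Prolongation n T'.obj) {w : Point T.obj} {q : Point T'.obj}
    (h : w ≫ T.delta T' T'' = T''.nabla q) :
    E.thickenΔ m n (pt k) ≫ (E.thicken (m + n)).map w ≫ T.r =
      (E.thicken m).map (Over.mkIdTerminal.from _) ≫ (E.thicken m).map q ≫ T'.r := by
  have h₁ := congrArg (fun t => (E.thicken m).map ((E.thicken n).map t ≫ T''.r) ≫ T'.r) h
  simp only [map_thicken_delta_r, map_thicken_deltaTranspose_r, map_thicken_nabla_r] at h₁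
  refine h₁.trans ?_
  rw [Functor.map_comp, Category.assoc]

/-- Augmenting `D m` in the transposed hypothesis collapses `Δ` to `π : D (m + n) → D n` on one side
and `q` to its base point on the other. -/
theorem nabla_base_of_delta_eq_nabla (T : E.Prolongation (m + n) X) (T' : E.Prolongation m X)
    (T'' : E.Prolongation n T'.obj) (T₁ : E.Prolongation n X) {w : Point T.obj}
    {q : Point T'.obj} (h : w ≫ T.delta T' T'' = T''.nabla q) :
    T₁.nabla (T'.base q) = w ≫ T.proj (Nat.le_add_left n m) T₁ := by
  apply T₁.hom_ext
  rw [map_thicken_proj_r, map_thicken_nabla_r, ← unit_thickenΔ, Category.assoc,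
    T.thickenΔ_eq_of_delta_eq_nabla T' T'' h, base, ← Category.assoc, ← unit_naturality,
    Category.assoc]

/-- The same with `D n` augmented: `Δ` collapses to `π : D (m + n) → D m`, and `q` is left
unchanged. -/
theorem proj_of_delta_eq_nabla (T : E.Prolongation (m + n) X) (T' : E.Prolongation m X)
    (T'' : E.Prolongation n T'.obj) {w : Point T.obj} {q : Point T'.obj}
    (h : w ≫ T.delta T' T'' = T''.nabla q) :
    w ≫ T.proj (Nat.le_add_right m n) T' = q := by
  apply T'.hom_ext
  rw [map_thicken_proj_r, ← map_unit_thickenΔ, Category.assoc,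
    T.thickenΔ_eq_of_delta_eq_nabla T' T'' h, ← Category.assoc, ← Functor.map_comp,
    Over.mkIdTerminal.hom_ext (E.unit n (pt k) ≫ Over.mkIdTerminal.from _) (𝟙 _),
    CategoryTheory.Functor.map_id, Category.id_comp]

end Prolongation

end

end IterativeHasseSchmidtRing

/-! ### Compatibility of closed prolongations with projections, `∇` and `δ`. -/

section

variable {B : Scheme.{u}}

/-- A closed immersion identifies its source with the closed subscheme given by its kernel. -/
theorem exists_iso_closedSub {V W : Over B} (j : V ⟶ W) [IsClosedImmersion j.left] :
    ∃ e : V ≅ closedSub W j.left.ker, e.hom ≫ closedSubι W j.left.ker = j := by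
  obtain ⟨g, hg⟩ := (exists_comp_closedSubι_iff j.left.ker j).mpr le_rfl
  have h₂ : IsIso j.left.toImage := inferInstance
  have h : IsIso g.left := by
    have h₁ : g.left = j.left.toImage :=
      (cancel_mono j.left.imageι).mp
        ((congrArg CommaMorphism.left hg).trans j.left.toImage_imageι.symm)
    exact h₁ ▸ h₂
  exact ⟨Over.isoMk (asIso g.left) (Over.w g), hg⟩

end

namespace IterativeHasseSchmidtRing

section

variable {A : Type u} [CommRing A] {S : IterativeHasseSchmidtSystem A}
variable {k : Type u} [CommRing k] [Algebra A k] {E : IterativeHasseSchmidtRing S k}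

namespace Prolongation

variable {W X : Over (Spec (CommRingCat.of k))} {m n : ℕ}

/-- The inclusion of the prolongation of a closed subscheme. -/
noncomputable def closedι (T : E.Prolongation n W) (I : W.left.IdealSheafData) :
    (T.closed I).obj ⟶ T.obj :=
  closedSubι T.obj (T.closedIdeal I)

instance (T : E.Prolongation n W) (I : W.left.IdealSheafData) :
    IsClosedImmersion (T.closedι I).left :=
  inferInstanceAs (IsClosedImmersion (closedSubι T.obj (T.closedIdeal I)).left)

instance (T : E.Prolongation n W) (I : W.left.IdealSheafData) : Mono (T.closedι I) :=
  inferInstanceAs (Mono (closedSubι T.obj (T.closedIdeal I)))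

theorem map_thicken_comp_closedι_r (T : E.Prolongation n W) (I : W.left.IdealSheafData)
    {U : Over (Spec (CommRingCat.of k))} (f : U ⟶ (T.closed I).obj) :
    (E.thicken n).map (f ≫ T.closedι I) ≫ T.r =
      ((E.thicken n).map f ≫ (T.closed I).r) ≫ closedSubι W I := by
  have h : (T.closed I).r ≫ closedSubι W I = (E.thicken n).map (T.closedι I) ≫ T.r :=
    T.closed_r_comp I
  rw [Functor.map_comp, Category.assoc, Category.assoc, h]

theorem closed_proj (h : n ≤ m) (T : E.Prolongation m W) (T' : E.Prolongation n W)
    (I : W.left.IdealSheafData) :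
    (T.closed I).proj h (T'.closed I) ≫ T'.closedι I = T.closedι I ≫ T.proj h T' := by
  apply T'.hom_ext
  have h₁ := map_thicken_proj_r h (T.closed I) (T'.closed I) (𝟙 _)
  have h₂ := T.map_thicken_comp_closedι_r I (𝟙 _)
  rw [Category.id_comp, CategoryTheory.Functor.map_id, Category.id_comp] at h₁ h₂
  rw [map_thicken_proj_r, map_thicken_comp_closedι_r, h₁, h₂, Category.assoc]

theorem closed_nabla (T : E.Prolongation n W) (I : W.left.IdealSheafData)
    (p : Point (closedSub W I)) :
    (T.closed I).nabla p ≫ T.closedι I = T.nabla (p ≫ closedSubι W I) := by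
  apply T.hom_ext
  rw [map_thicken_comp_closedι_r, map_thicken_nabla_r, map_thicken_nabla_r, Category.assoc]

theorem closed_deltaTranspose (T : E.Prolongation (m + n) W) (T' : E.Prolongation m W)
    (I : W.left.IdealSheafData) :
    (T.closed I).deltaTranspose (T'.closed I) ≫ T'.closedι I =
      (E.thicken n).map (T.closedι I) ≫ T.deltaTranspose T' := by
  apply T'.hom_ext
  have h₁ := map_thicken_deltaTranspose_r (T.closed I) (T'.closed I) (𝟙 _)
  have h₂ := T.map_thicken_comp_closedι_r I (𝟙 _)
  rw [CategoryTheory.Functor.map_id, Category.id_comp, CategoryTheory.Functor.map_id,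
    Category.id_comp] at h₁
  rw [Category.id_comp, CategoryTheory.Functor.map_id, Category.id_comp] at h₂
  rw [map_thicken_deltaTranspose_r, map_thicken_comp_closedι_r, h₁, h₂, Category.assoc]

theorem proj_refl (T : E.Prolongation n X) : T.proj (le_refl n) T = 𝟙 _ := by
  apply T.hom_ext
  rw [proj, thicken_map_lift, thickenπ_refl, CategoryTheory.Functor.map_id]

theorem proj_proj {l : ℕ} (h : n ≤ m) (h' : m ≤ l) (T : E.Prolongation l X)
    (T₁ : E.Prolongation m X) (T₂ : E.Prolongation n X) :
    T.proj h' T₁ ≫ T₁.proj h T₂ = T.proj (h.trans h') T₂ := by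
  apply T₂.hom_ext
  rw [map_thicken_proj_r, proj, thicken_map_lift, proj, thicken_map_lift, ← Category.assoc,
    thickenπ_trans]

theorem proj_delta {n' : ℕ} (h : n' ≤ n) (T : E.Prolongation (m + n) X)
    (T₁ : E.Prolongation (m + n') X) (T' : E.Prolongation m X) (T'' : E.Prolongation n T'.obj)
    (T₁'' : E.Prolongation n' T'.obj) :
    T.proj (Nat.add_le_add_left h m) T₁ ≫ T₁.delta T' T₁'' =
      T.delta T' T'' ≫ T''.proj h T₁'' := by
  apply T₁''.hom_ext
  apply T'.hom_ext
  have h₀ := E.thickenΔ_π (le_refl m) h T.obj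
  rw [thickenπ_refl, Category.id_comp] at h₀
  have h₁ := map_thicken_proj_r (Nat.add_le_add_left h m) T T₁ (𝟙 _)
  rw [Category.id_comp, CategoryTheory.Functor.map_id, Category.id_comp] at h₁
  have h₂ := map_thicken_delta_r T T' T'' (𝟙 _)
  rw [Category.id_comp, CategoryTheory.Functor.map_id, Category.id_comp] at h₂
  have h₃ := map_thicken_deltaTranspose_r T T' (𝟙 _)
  rw [CategoryTheory.Functor.map_id, Category.id_comp, CategoryTheory.Functor.map_id,
    Category.id_comp] at h₃
  rw [map_thicken_delta_r, map_thicken_deltaTranspose_r, map_thicken_proj_r, h₁, h₂,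
    Functor.map_comp, Category.assoc, h₃, ← Category.assoc, ← Category.assoc, h₀]

/-- Associativity of `Δ` for the triple `(m, n, 1)`, transposed. It converts the second
Hasse-Schmidt condition for `Z` at level `m + n` into the one for `Y` at level `n`. -/
theorem deltaTranspose_delta (T : E.Prolongation (m + (n + 1)) X) (T₁ : E.Prolongation (m + n) X)
    (T' : E.Prolongation m X) (T'' : E.Prolongation (n + 1) T'.obj)
    (T₁'' : E.Prolongation n T'.obj) :
    deltaTranspose (m := m + n) (n := 1) T T₁ ≫ T₁.delta T' T₁'' =
      (E.thicken 1).map (T.delta T' T'') ≫ T''.deltaTranspose T₁'' := by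
  apply T₁''.hom_ext
  apply T'.hom_ext
  have h₀ := E.thickenΔ_assoc m n 1 T.obj
  -- `m + (n + 1)` is definitionally `m + n + 1`, so the change of index in the associativity law is
  -- the identity.
  have h₀' : E.thickenπ (add_assoc m n 1).le T.obj ≫ T.r = T.r :=
    (congrArg (fun t => t ≫ T.r) (E.thickenπ_refl (m + n + 1) T.obj)).trans (Category.id_comp _)
  have h₁ := map_thicken_deltaTranspose_r (m := m + n) (n := 1) T T₁ (𝟙 _)
  rw [CategoryTheory.Functor.map_id, Category.id_comp, CategoryTheory.Functor.map_id,
    Category.id_comp] at h₁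
  have h₂ := map_thicken_delta_r T T' T'' (𝟙 _)
  rw [Category.id_comp, CategoryTheory.Functor.map_id, Category.id_comp] at h₂
  have h₃ := map_thicken_deltaTranspose_r T T' (𝟙 _)
  rw [CategoryTheory.Functor.map_id, Category.id_comp, CategoryTheory.Functor.map_id,
    Category.id_comp] at h₃
  rw [map_thicken_delta_r, map_thicken_deltaTranspose_r, map_thicken_deltaTranspose_r, h₁, h₂,
    Functor.map_comp, Category.assoc, h₃, ← Category.assoc, ← Category.assoc, h₀]
  simp only [Category.assoc]
  exact congrArg (fun t => _ ≫ _ ≫ t) h₀'.symm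

end Prolongation

namespace HSSubscheme

variable {X : Over (Spec (CommRingCat.of k))} {τ : E.Prolongations X} (Z : E.HSSubscheme τ)

theorem proj_restricts_le {m n : ℕ} (h : n ≤ m) :
    ∃ f : Z.level m ⟶ Z.level n, f ≫ Z.levelι n = Z.levelι m ≫ (τ m).proj h (τ n) := by
  induction m, h using Nat.le_induction with
  | base =>
    refine ⟨𝟙 _, ?_⟩
    rw [Prolongation.proj_refl, Category.id_comp, Category.comp_id]
  | succ m h ih =>
    obtain ⟨f, hf⟩ := ih
    obtain ⟨g, hg⟩ := Z.proj_restricts m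
    refine ⟨g ≫ f, ?_⟩
    rw [Category.assoc, hf, ← Category.assoc, hg, Category.assoc, Prolongation.proj_proj]

end HSSubscheme

end

/-! ### The consequence of richness. -/

section

variable {A : Type u} [CommRing A] {S : IterativeHasseSchmidtSystem A}
variable {k : Type u} [Field k] [Algebra A k] {E : IterativeHasseSchmidtRing S k}

namespace HSSubscheme

variable {X : Over (Spec (CommRingCat.of k))} {τ : E.Prolongations X} (Z : E.HSSubscheme τ)

/-- Over a rich field, `τ (m + n) X → τ n (τ m X)` restricts to `Z (m + n) → τ n (Z m)`. -/
theorem exists_comp_closedSubι_eq_delta (hE : E.Rich) (hX : IsVarietyOver X)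
    (ττ : ∀ m : ℕ, E.Prolongations (τ m).obj) (hZ : Z.IsSubvariety) (hZd : Z.Dominant)
    (hZi : Z.Irreducible) (m n : ℕ) :
    ∃ j : Z.level (m + n) ⟶ ((ττ m n).closed (Z.Z m)).obj,
      j ≫ (ττ m n).closedι (Z.Z m) =
        Z.levelι (m + n) ≫ (τ (m + n)).delta (τ m) (ττ m n) := by
  refine (exists_comp_closedSubι_iff _ _).mpr ?_
  set f := Z.levelι (m + n) ≫ (τ (m + n)).delta (τ m) (ττ m n) with hf
  set J := (ττ m n).closedIdeal (Z.Z m)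
  have hr := (hZ (m + n)).1
  have hd := hE X hX τ (fun m => ⟨ττ m⟩) Z hZ hZd hZi (m + n)
  rw [← Scheme.IdealSheafData.map_bot, Scheme.IdealSheafData.le_map_iff_comap_le]
  -- On the reduced scheme `Z (m + n)` an ideal sheaf with full support is zero, so it is enough
  -- that the closed support contains the dense set of points `∇ (m + n) p`.
  refine (Scheme.IdealSheafData.support_eq_top_iff.mp ?_).le
  have hpt : ∀ p ∈ Z.points, Set.range ((τ (m + n)).nabla p).left ⊆
      (Z.levelι (m + n)).left '' (J.comap f.left).support := by
    intro p hp
    obtain ⟨q, hq⟩ := hp (m + n)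
    obtain ⟨q', hq'⟩ := hp m
    have h₁ : q ≫ f = (ττ m n).nabla ((τ m).nabla p) := by
      rw [hf, ← Category.assoc, hq, Prolongation.nabla_delta]
    have h₂ : J ≤ (q ≫ f).left.ker := by
      rw [h₁, Prolongation.closedIdeal_le_ker_iff, Prolongation.map_thicken_nabla_r]
      refine (exists_comp_closedSubι_iff _ _).mp ⟨Over.mkIdTerminal.from _ ≫ q', ?_⟩
      rw [Category.assoc, hq']
    rw [Over.comp_left, Scheme.Hom.ker_comp, Scheme.IdealSheafData.le_map_iff_comap_le] at h₂
    rintro _ ⟨x, rfl⟩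
    refine ⟨q.left x, ?_, ?_⟩
    · exact Scheme.IdealSheafData.support_antitone h₂ (q.left.range_subset_ker_support ⟨x, rfl⟩)
    · rw [← hq]
      rfl
  have hcl : IsClosed ((Z.levelι (m + n)).left '' (J.comap f.left).support) :=
    (Z.levelι (m + n)).left.isClosedEmbedding.isClosedMap _ (J.comap f.left).support.isClosed
  have h := (closure_minimal (Set.iUnion₂_subset hpt) hcl)
  rw [hd] at h
  ext x
  simp only [TopologicalSpace.Closeds.coe_top, Set.mem_univ, iff_true]
  obtain ⟨y, hy, hyx⟩ := h ⟨x, rfl⟩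
  rwa [← (Z.levelι (m + n)).left.isClosedEmbedding.injective hyx]

end HSSubscheme

end

end IterativeHasseSchmidtRing

/-! ### Construction of `Y` and comparison of points. -/

theorem proposition3p13 {A : Type u} [CommRing A] (S : IterativeHasseSchmidtSystem A)
    {k : Type u} [Field k] [Algebra A k] (E : IterativeHasseSchmidtRing S k) (hE : E.Rich)
    (X : Over (Spec (CommRingCat.of k))) (hX : IsVarietyOver X)
    (τ : E.Prolongations X) (ττ : ∀ m : ℕ, E.Prolongations (τ m).obj)
    (Z : E.HSSubscheme τ) (hZ : Z.IsSubvariety) (hZd : Z.Dominant) (hZi : Z.Irreducible) (m : ℕ) :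
    ∃ (σ : E.Prolongations (Z.level m)) (Y : E.HSSubscheme σ),
      Y.IsSubvariety ∧ Y.Dominant ∧
      (fun q => q ≫ Z.levelι m) '' Y.points = (τ m).nabla '' Z.points ∧
      ∀ n : ℕ, ∃ e : Z.level (m + n) ≅ Y.level n,
        e.hom ≫ Y.levelι n ≫ (σ n).map (ττ m n) (Z.levelι m) =
          Z.levelι (m + n) ≫ (τ (m + n)).delta (τ m) (ττ m n) := by
  have hsep : IsSeparated X.hom := hX.isSeparated
  choose j hj using Z.exists_comp_closedSubι_eq_delta hE hX ττ hZ hZd hZi m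
  have hjc : ∀ n, IsClosedImmersion (j n).left := fun n => by
    have := (hZ (m + n)).2.1
    have := (hZ (m + n)).2.2
    have h := IterativeHasseSchmidtRing.Prolongation.isClosedImmersion_comp_delta (τ (m + n)) (τ m) (ττ m n)
      (Z.levelι (m + n))
    rw [← hj n, Over.comp_left] at h
    exact .of_comp_isClosedImmersion _ ((ττ m n).closedι (Z.Z m)).left
  choose e he using fun n => exists_iso_closedSub (j n)
  have hei : ∀ n, (e n).inv ≫ j n = closedSubι _ _ := fun n => by
    rw [Iso.inv_comp_eq, he]
  -- Stated for an arbitrary restriction `p`, so that it serves both the existence of `Y (n + 1) → Y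
  -- n` and, with the dominant `p`, its dominance.
  have hproj : ∀ n (p : Z.level (m + (n + 1)) ⟶ Z.level (m + n)),
      p ≫ Z.levelι (m + n) = Z.levelι (m + (n + 1)) ≫
        (τ (m + n + 1)).proj (Nat.le_succ (m + n)) (τ (m + n)) →
      ((e (n + 1)).inv ≫ p ≫ (e n).hom) ≫ closedSubι _ _ = closedSubι _ _ ≫
        ((ττ m (n + 1)).closed (Z.Z m)).proj (Nat.le_succ n) ((ττ m n).closed (Z.Z m)) := by
    intro n p hp
    rw [Category.assoc, Category.assoc, he, ← hei, Category.assoc,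
      ← cancel_mono ((ττ m n).closedι (Z.Z m))]
    simp only [Category.assoc]
    rw [IterativeHasseSchmidtRing.Prolongation.closed_proj, hj, ← Category.assoc p, hp, ← Category.assoc (j (n + 1)), hj,
      Category.assoc, Category.assoc, ← IterativeHasseSchmidtRing.Prolongation.proj_delta]
    rfl
  let Y : E.HSSubscheme fun n => (ττ m n).closed (Z.Z m) :=
    { Z := fun n => (j n).left.ker
      proj_restricts := fun n => by
        obtain ⟨p, hp⟩ := Z.proj_restricts (m + n)
        exact ⟨_, hproj n p hp⟩
      delta_restricts := fun n => by
        obtain ⟨d, hd⟩ := Z.delta_restricts (m + n)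
        refine ⟨(E.thicken 1).map (e (n + 1)).inv ≫ d ≫ (e n).hom, ?_⟩
        rw [Category.assoc, Category.assoc, he, ← hei, Functor.map_comp, Category.assoc,
          ← cancel_mono ((ττ m n).closedι (Z.Z m))]
        simp only [Category.assoc]
        rw [IterativeHasseSchmidtRing.Prolongation.closed_deltaTranspose, hj, ← Category.assoc d, hd, Category.assoc,
          IterativeHasseSchmidtRing.Prolongation.deltaTranspose_delta _ _ _ (ττ m (n + 1))]
        have h := congrArg (fun t => (E.thicken 1).map t ≫
          (ττ m (n + 1)).deltaTranspose (ττ m n)) (hj (n + 1))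
        simp only [Functor.map_comp, Category.assoc] at h
        rw [h]
        rfl }
  have hi : ∀ n, IsIso (e n).inv.left := fun n =>
    inferInstanceAs (IsIso ((Over.forget _).map (e n).inv))
  have hh : ∀ n, IsIso (e n).hom.left := fun n =>
    inferInstanceAs (IsIso ((Over.forget _).map (e n).hom))
  have hYι : ∀ n, Y.levelι n ≫ (ττ m n).closedι (Z.Z m) =
      (e n).inv ≫ Z.levelι (m + n) ≫ (τ (m + n)).delta (τ m) (ττ m n) := fun n => by
    rw [← hj, ← Category.assoc, hei]
  refine ⟨_, Y, fun n => ?_, fun n => ?_, ?_, fun n => ⟨e n, ?_⟩⟩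
  · have h₁ := hZ (m + n)
    have := h₁.1
    have := h₁.2.1
    have := h₁.2.2
    have := hi n
    have he' : (Y.level n).hom = (e n).inv.left ≫ (Z.level (m + n)).hom := (Over.w _).symm
    rw [he']
    exact ⟨isReduced_of_isOpenImmersion (e n).inv.left, inferInstance, inferInstance⟩
  · obtain ⟨p, hp, hpd⟩ := hZd (m + n)
    exact ⟨_, hproj n p hp, by
      have := hi (n + 1)
      have := hh n
      rw [Over.comp_left, Over.comp_left]
      infer_instance⟩
  · ext q
    constructor
    · rintro ⟨z, hz, rfl⟩
      choose y hy using hz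
      have hw : ∀ n, (y n ≫ (e n).inv ≫ Z.levelι (m + n)) ≫ (τ (m + n)).delta (τ m) (ττ m n) =
          (ττ m n).nabla (z ≫ Z.levelι m) := fun n => by
        rw [Category.assoc, Category.assoc, ← hYι, ← Category.assoc, hy]
        exact IterativeHasseSchmidtRing.Prolongation.closed_nabla _ _ _
      -- The preimage of `q` under `∇ m` is the point of `X` below it.
      refine ⟨(τ m).base (z ≫ Z.levelι m), fun n => ?_, ?_⟩
      · obtain ⟨f, hf⟩ := Z.proj_restricts_le (Nat.le_add_left n m)
        refine ⟨y n ≫ (e n).inv ≫ f, ?_⟩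
        rw [IterativeHasseSchmidtRing.Prolongation.nabla_base_of_delta_eq_nabla _ _ _ (τ n) (hw n)]
        simp only [Category.assoc, hf]
      -- At `n = m` the projections of `τ (m + m) X` obtained from the two counit laws are the same
      -- morphism to `τ m X`. One law makes the image of the point `∇ m p`, the other makes it `q`.
      · rw [IterativeHasseSchmidtRing.Prolongation.nabla_base_of_delta_eq_nabla _ _ _ (τ m) (hw m)]
        exact IterativeHasseSchmidtRing.Prolongation.proj_of_delta_eq_nabla _ _ _ (hw m)
    · rintro ⟨p, hp, rfl⟩
      obtain ⟨z, hz⟩ := hp m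
      refine ⟨z, fun n => ?_, hz⟩
      obtain ⟨w, hw⟩ := hp (m + n)
      refine ⟨w ≫ (e n).hom, ?_⟩
      rw [← cancel_mono ((ττ m n).closedι (Z.Z m)), IterativeHasseSchmidtRing.Prolongation.closed_nabla, hz,
        ← IterativeHasseSchmidtRing.Prolongation.nabla_delta (τ (m + n)), ← hw, Category.assoc, hYι]
      simp only [Category.assoc, Iso.hom_inv_id_assoc]
  · have h : ((ττ m n).closed (Z.Z m)).map (ττ m n) (Z.levelι m) = (ττ m n).closedι (Z.Z m) :=
      (ττ m n).closed_map (Z.Z m)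
    rw [h, hYι, Iso.hom_inv_id_assoc]
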